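/- Let $N>1$ and let $\Omega\subset\mathbb{R}^N$ be a bounded Lipschitz domain. Let $M:\Omega\times\mathbb{R}^N\to\mathbb{R}$ be an $N$-function, i.e.: $M(\cdot,\xi)$ is measurable for every $\xi$; for a.e. $x\in\Omega$ the function $M(x,\cdot)$ is continuous, convex and even, and $M(x,\xi)=0$ if and only if $\xi=0$; moreover $\lim_{|\xi|\to0}\operatorname{ess\,sup}_{x\in\Omega}\frac{M(x,\xi)}{|\xi|}=0$ and $\lim_{|\xi|\to\infty}\operatorname{ess\,inf}_{x\in\Omega}\frac{M(x,\xi)}{|\xi|}=\infty$. Assume that $M$ satisfies condition (M): $\int_G M(x,z)\,dx<\infty$ for every measurable $G\subset\Omega$ and every $z\in\mathbb{R}^N$, and there are constants $a,b,c,\delta_0>0$ such that for every $\delta\in(0,\delta_0)$ there is a finite family of closed cubes $Q^\delta_1,\dots,Q^\delta_{N_\delta}$ of edge $2\delta$ with pairwise disjoint interiors and $\Omega\subset\bigcup_j Q^\delta_j$, for which $$M(x,\xi)\le c\left(1+|\xi|^{-\frac{a}{\log(b\delta)}}\right)(M^\delta_j)^{**}(\xi)\qquad\text{for all } j,\ x\in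 Q^\delta_j\cap\Omega,\ \xi\in\mathbb{R}^N\setminus\{0\}.$$ Here $M^\delta_j(\xi)=\inf_{x\in\widetilde Q^\delta_j\cap\Omega}M(x,\xi)$, where $\widetilde Q^\delta_j$ is the cube of edge $4\delta$ with the same centre as $Q^\delta_j$ and edges parallel to those of $Q^\delta_j$, and $f^{**}=(f^*)^*$ is the second conjugate, with $f^*(\eta)=\sup_{\xi\in\mathbb{R}^N}(\xi\cdot\eta-f(\xi))$. Let $L_M(\Omega;\mathbb{R}^N)$ be the smallest linear space containing all measurable $\xi:\Omega\to\mathbb{R}^N$ with $\int_\Omega M(x,\xi(x))\,dx<\infty$, and let $V_0^M=\{u\in W_0^{1,1}(\Omega):\nabla u\in L_M(\Omega;\mathbb{R}^N)\}$. Then for every $\varphi\in V_0^M\cap L^\infty(\Omega)$ there is a family $\{\varphi_\delta\}_{\delta>0}\subset C_0^\infty(\Omega)$ such that $\nabla\varphi_\delta$ converges modularly to $\nabla\varphi$ in $L_M(\Omega;\mathbb{R}^N)$ as $\delta\to0^+$, i.e. there is $\lambda>0$ with $$\int_\Omega M\left(x,\frac{\nabla\varphi_\delta(x)-\nabla\varphi(x)}{\lambda}\right)dx\to0\qquad\text{as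 }\delta\to0^+ .$$ -/

import Mathlib

open MeasureTheory Filter Topology
open scoped ENNReal ContDiff

namespace MusielakOrlicz

noncomputable section

/-- The Euclidean space `ℝ^N`. -/
abbrev RN (N : ℕ) : Type := EuclideanSpace ℝ (Fin N)

/-! ### Domains -/

/-- `Ω` is an open set with Lipschitz boundary: near every boundary point, and after a choice of a
"vertical" unit direction `e`, the set `Ω` is the strict supergraph of a Lipschitz function `γ` of
the orthogonal projection `x - ⟪e, x⟫ e` of `x` to the hyperplane `e^⊥`.
(Only the restriction of `γ` to `e^⊥` matters. Connectedness is not required.) -/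
structure IsLipschitzDomain {N : ℕ} (Ω : Set (RN N)) : Prop where
  isOpen : IsOpen Ω
  locally_supergraph : ∀ x₀ ∈ frontier Ω, ∃ r > (0 : ℝ), ∃ e : RN N, ‖e‖ = 1 ∧
    ∃ (L : NNReal) (γ : RN N → ℝ), LipschitzWith L γ ∧
      Ω ∩ Metric.ball x₀ r =
        {x | γ (x - (inner ℝ e x) • e) < inner ℝ e x} ∩ Metric.ball x₀ r

/-! ### Test functions, weak gradients, `W_0^{1,1}` -/

/-- `ψ ∈ C_0^∞(Ω)`: smooth on `ℝ^N` with compact support contained in `Ω`. -/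
structure IsTestFunction {N : ℕ} (Ω : Set (RN N)) (ψ : RN N → ℝ) : Prop where
  smooth : ContDiff ℝ ∞ ψ
  compact_support : HasCompactSupport ψ
  support_subset : tsupport ψ ⊆ Ω

/-- `g` is the weak (distributional) gradient of `u` in `Ω`. -/
structure IsWeakGradient {N : ℕ} (Ω : Set (RN N)) (u : RN N → ℝ) (g : RN N → RN N) : Prop where
  locallyIntegrableOn : LocallyIntegrableOn u Ω
  grad_locallyIntegrableOn : LocallyIntegrableOn g Ω
  integral_eq : ∀ ψ : RN N → ℝ, IsTestFunction Ω ψ → ∀ i : Fin N,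
    ∫ x in Ω, u x * (gradient ψ x) i = - ∫ x in Ω, (g x) i * ψ x

/-- `u ∈ W_0^{1,1}(Ω)`: `u ∈ W^{1,1}(Ω)` and `u` lies in the closure of `C_0^∞(Ω)` with respect to
the `W^{1,1}(Ω)`-norm. -/
def MemW011 {N : ℕ} (Ω : Set (RN N)) (u : RN N → ℝ) : Prop :=
  ∃ g : RN N → RN N, IsWeakGradient Ω u g ∧ IntegrableOn u Ω ∧ IntegrableOn g Ω ∧
    ∀ ε : ℝ≥0∞, 0 < ε → ∃ ψ : RN N → ℝ, IsTestFunction Ω ψ ∧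
      eLpNorm (fun x => u x - ψ x) 1 (volume.restrict Ω) +
        eLpNorm (fun x => g x - gradient ψ x) 1 (volume.restrict Ω) < ε

/-! ### `N`-functions and Musielak-Orlicz spaces -/

/-- `M : Ω × ℝ^N → ℝ` is an `N`-function. (Only the values `M x ξ` with `x ∈ Ω` matter.)
The essential supremum and infimum are taken in `[0, ∞]`; `M x ξ / |ξ|` is nonnegative for
a.e. `x ∈ Ω` by evenness, convexity and `M x 0 = 0`. -/
structure IsNFunction {N : ℕ} (Ω : Set (RN N)) (M : RN N → RN N → ℝ) : Prop where
  measurable : ∀ ξ, AEMeasurable (fun x => M x ξ) (volume.restrict Ω)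
  continuous : ∀ᵐ x ∂(volume.restrict Ω), Continuous (M x)
  eq_zero_iff : ∀ᵐ x ∂(volume.restrict Ω), ∀ ξ, M x ξ = 0 ↔ ξ = 0
  even : ∀ᵐ x ∂(volume.restrict Ω), ∀ ξ, M x (-ξ) = M x ξ
  convex : ∀ᵐ x ∂(volume.restrict Ω), ConvexOn ℝ Set.univ (M x)
  sublinear_at_zero :
    Tendsto (fun ξ : RN N =>
      essSup (fun x => ENNReal.ofReal (M x ξ / ‖ξ‖)) (volume.restrict Ω)) (𝓝[≠] 0) (𝓝 0)
  superlinear_at_infty :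
    Tendsto (fun ξ : RN N =>
      essInf (fun x => ENNReal.ofReal (M x ξ / ‖ξ‖)) (volume.restrict Ω))
      (Bornology.cobounded (RN N)) (𝓝 ⊤)

/-- The modular `∫_Ω M(x, ξ(x)) dx ∈ [0, ∞]`. -/
def modular {N : ℕ} (Ω : Set (RN N)) (M : RN N → RN N → ℝ) (ξ : RN N → RN N) : ℝ≥0∞ :=
  ∫⁻ x in Ω, ENNReal.ofReal (M x (ξ x))

/-- The generalised Orlicz-Musielak class: measurable `ξ : Ω → ℝ^N` with finite modular. -/
def orliczClass {N : ℕ} (Ω : Set (RN N)) (M : RN N → RN N → ℝ) : Set (RN N → RN N) :=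
  {ξ | AEStronglyMeasurable ξ (volume.restrict Ω) ∧ modular Ω M ξ < ⊤}

/-- The generalised Orlicz-Musielak space `L_M(Ω; ℝ^N)`: the smallest linear space containing the
Orlicz-Musielak class. -/
def orliczSpace {N : ℕ} (Ω : Set (RN N)) (M : RN N → RN N → ℝ) : Submodule ℝ (RN N → RN N) :=
  Submodule.span ℝ (orliczClass Ω M)

/-- Modular convergence `ξ_i → ξ` in `L_M(Ω; ℝ^N)` along the filter `l`: for some `lam > 0`,
`∫_Ω M(x, (ξ_i - ξ) / lam) dx → 0`. -/
def ModularTendsto {N : ℕ} {ι : Type*} (Ω : Set (RN N)) (M : RN N → RN N → ℝ)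
    (ξs : ι → RN N → RN N) (l : Filter ι) (ξ : RN N → RN N) : Prop :=
  (∀ᶠ i in l, ξs i ∈ orliczSpace Ω M) ∧ ξ ∈ orliczSpace Ω M ∧
    ∃ lam > (0 : ℝ),
      Tendsto (fun i => modular Ω M (fun x => lam⁻¹ • (ξs i x - ξ x))) l (𝓝 0)

/-- `u ∈ V_0^M`: `u ∈ W_0^{1,1}(Ω)` and `∇u ∈ L_M(Ω; ℝ^N)`. -/
def MemV0 {N : ℕ} (Ω : Set (RN N)) (M : RN N → RN N → ℝ) (u : RN N → ℝ) : Prop :=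
  MemW011 Ω u ∧ ∃ g : RN N → RN N, IsWeakGradient Ω u g ∧ g ∈ orliczSpace Ω M

/-! ### The regularity condition (M) -/

/-- The closed cube with centre `p`, edge length `2 * s` and edges parallel to the orthonormal frame
given by the linear isometry `R`. -/
def cube {N : ℕ} (R : RN N ≃ₗᵢ[ℝ] RN N) (p : RN N) (s : ℝ) : Set (RN N) :=
  {x | ∀ i, |(R (x - p)) i| ≤ s}

/-- The complementary (Legendre-Fenchel conjugate) function, with values in `[-∞, ∞]`. -/
def conjugate {N : ℕ} (f : RN N → EReal) (η : RN N) : EReal :=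
  ⨆ ξ : RN N, (((inner ℝ ξ η : ℝ) : EReal) - f ξ)

/-- The infimum of `M(x, ξ)` over `x` in the set `S`. -/
def infOver {N : ℕ} (M : RN N → RN N → ℝ) (S : Set (RN N)) (ξ : RN N) : EReal :=
  ⨅ x ∈ S, (M x ξ : EReal)

/-- Condition (M). All `M(·, z)` are integrable over measurable subsets of `Ω`, and there are
positive constants `a, b, c, δ₀` such that for each `δ < δ₀` there is a finite covering of `Ω` by
closed cubes `Q_j` of edge `2δ` with pairwise disjoint interiors such that, `Q̃_j` being the
concentric and parallel cube of edge `4δ` and `M_j` the infimum of `M` over `Q̃_j ∩ Ω`,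
`M(x, ξ) / M_j^{**}(ξ) ≤ c (1 + |ξ|^{-a / log (b δ)})` for `x ∈ Q_j ∩ Ω` and `ξ ≠ 0`.
The inequality is written without division, so that `M_j^{**}(ξ)` is forced to be positive where
`M(x, ξ)` is. -/
def ConditionM {N : ℕ} (Ω : Set (RN N)) (M : RN N → RN N → ℝ) : Prop :=
  (∀ G : Set (RN N), MeasurableSet G → G ⊆ Ω → ∀ z : RN N,
    ∫⁻ x in G, ENNReal.ofReal (M x z) < ⊤) ∧
  ∃ a b c δ₀ : ℝ, 0 < a ∧ 0 < b ∧ 0 < c ∧ 0 < δ₀ ∧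
    ∀ δ : ℝ, 0 < δ → δ < δ₀ →
      ∃ (n : ℕ) (p : Fin n → RN N) (R : Fin n → (RN N ≃ₗᵢ[ℝ] RN N)),
        (∀ i j, i ≠ j → Disjoint (interior (cube (R i) (p i) δ)) (interior (cube (R j) (p j) δ))) ∧
        Ω ⊆ ⋃ j, cube (R j) (p j) δ ∧
        ∀ j, ∀ x ∈ cube (R j) (p j) δ ∩ Ω, ∀ ξ : RN N, ξ ≠ 0 →
          (M x ξ : EReal) ≤
            ((c * (1 + ‖ξ‖ ^ (-a / Real.log (b * δ))) : ℝ) : EReal) *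
              conjugate (conjugate (infOver M (cube (R j) (p j) (2 * δ) ∩ Ω))) ξ

end

end MusielakOrlicz

/-! The approximants are mollifications of localized pieces of φ. Correct M on a null set, extend φ
by zero, and cut it with a finite smooth partition of unity whose members each come with an inward
direction v. A piece u = θφ is convolved with a kernel η_δ concentrated near δv; the shift pushes
the support into Ω, so η_δ * u is a test function for small δ.

Let G be the weak gradient of u. The gradient of η_δ * u is read in two ways. With the derivative on
the kernel, boundedness of u gives a bound of order 1/δ (`IsMollifier.norm_gradient_average_le`),
and for vectors of that size the factor |ξ|^(-a / log(bδ)) in condition (M) stays bounded as δ → 0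
(`eventually_rpow_le`). With the derivative on u, it is η_δ * G (`IsMollifier.gradient_average`),
and Jensen's inequality for the convex function (M_j)**, which lies below M(y, ·) for every y of the
enlarged cube in Ω, bounds (M_j)** at η_δ * tG by η_δ * M(·, tG)
(`IsMollifier.biconjugate_average_le`). Condition (M) joins the two readings: M(x, t∇(η_δ * u)) ≤ B
(η_δ * M(·, tG))(x), with B independent of δ.

Choose t > 0 with M(·, tG) integrable. The right side then converges in L¹, and η_δ * G → G in L¹,
so a dominated convergence argument gives modular convergence at scale t/2
(`ConditionM.tendsto_modular_average`). Convexity allows finitely many pieces to be added at the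
price of a smaller scale, and the pieces of the gradient sum to ∇φ because the partition functions
sum to 1 on Ω. -/

namespace MusielakOrlicz

/-! ### Convex integrands, their modulars and Orlicz spaces -/

/-- A jointly measurable integrand that is continuous, convex and even in its second variable and
vanishes at the origin, for every `x`. -/
structure IsConvexIntegrand {N : ℕ} (M : RN N → RN N → ℝ) : Prop where
  measurable : Measurable (Function.uncurry M)
  continuous : ∀ x, Continuous (M x)
  zero : ∀ x, M x 0 = 0
  even : ∀ x ξ, M x (-ξ) = M x ξ
  convex : ∀ x, ConvexOn ℝ Set.univ (M x)

variable {N : ℕ} {Ω : Set (RN N)} {M : RN N → RN N → ℝ}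

/-- An `N`-function agrees, for almost every `x ∈ Ω`, with a convex integrand. -/
theorem IsNFunction.exists_isConvexIntegrand (hΩ : MeasurableSet Ω) (hM : IsNFunction Ω M) :
    ∃ (S : Set (RN N)) (M' : RN N → RN N → ℝ), MeasurableSet S ∧ S ⊆ Ω ∧
      (∀ᵐ x ∂(volume.restrict Ω), x ∈ S) ∧ (∀ x ∈ S, M' x = M x) ∧ (∀ x ∉ S, M' x = 0) ∧
      IsConvexIntegrand M' := by
  set d := TopologicalSpace.denseSeq (RN N)
  have hae : ∀ᵐ x ∂(volume.restrict Ω), Continuous (M x) ∧ (∀ ξ, M x ξ = 0 ↔ ξ = 0) ∧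
      (∀ ξ, M x (-ξ) = M x ξ) ∧ ConvexOn ℝ Set.univ (M x) ∧
      ∀ n, M x (d n) = (hM.measurable (d n)).mk _ x := by
    have := ae_all_iff.2 fun n => (hM.measurable (d n)).ae_eq_mk
    filter_upwards [hM.continuous, hM.eq_zero_iff, hM.even, hM.convex, this] with x h1 h2 h3 h4 h5
    exact ⟨h1, h2, h3, h4, h5⟩
  -- The exceptional null set need not be measurable; it is enlarged to a measurable null set so
  -- that cutting M off there preserves measurability.
  obtain ⟨t, ht, htm, ht0⟩ := exists_measurable_superset_of_null (ae_iff.1 hae)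
  have hS : MeasurableSet (Ω ∩ tᶜ) := hΩ.inter htm.compl
  have hgood : ∀ x ∈ Ω ∩ tᶜ, Continuous (M x) ∧ (∀ ξ, M x ξ = 0 ↔ ξ = 0) ∧
      (∀ ξ, M x (-ξ) = M x ξ) ∧ ConvexOn ℝ Set.univ (M x) ∧
      ∀ n, M x (d n) = (hM.measurable (d n)).mk _ x := fun x hx => by
    by_contra h
    exact hx.2 (ht h)
  classical
  refine ⟨Ω ∩ tᶜ, fun x => if x ∈ Ω ∩ tᶜ then M x else 0, hS, Set.inter_subset_left, ?_,
    fun x hx => if_pos hx, fun x hx => if_neg hx, ?_⟩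
  · filter_upwards [ae_restrict_mem hΩ, compl_mem_ae_iff.2 ht0] with x h1 h2 using ⟨h1, h2⟩
  have hcont : ∀ x, Continuous ((fun x => if x ∈ Ω ∩ tᶜ then M x else 0) x) := fun x => by
    by_cases hx : x ∈ Ω ∩ tᶜ
    · simpa only [if_pos hx] using (hgood x hx).1
    · simpa only [if_neg hx] using continuous_zero
  -- Each M(·, ξ) has its own null set, so only the countably many ξ of a dense sequence can be
  -- corrected at once. Other ξ follow as limits by continuity, and joint measurability is then that
  -- of a Carathéodory function.
  have hmeas : ∀ ξ, Measurable fun x => (if x ∈ Ω ∩ tᶜ then M x else 0) ξ := fun ξ => by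
    obtain ⟨s, hs, hlim⟩ := mem_closure_iff_seq_limit.1
      ((TopologicalSpace.denseRange_denseSeq (RN N)) ξ)
    choose k hk using hs
    refine measurable_of_tendsto_metrizable (f := fun n x => (if x ∈ Ω ∩ tᶜ then M x else 0) (s n))
      (fun n => ?_) (tendsto_pi_nhds.2 fun x => ((hcont x).tendsto ξ).comp hlim)
    have : (fun x => (if x ∈ Ω ∩ tᶜ then M x else 0) (s n)) =
        (Ω ∩ tᶜ).indicator ((hM.measurable (d (k n))).mk _) := by
      ext x
      by_cases hx : x ∈ Ω ∩ tᶜ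
      · rw [if_pos hx, Set.indicator_of_mem hx, ← (hgood x hx).2.2.2.2, ← hk n]
      · rw [if_neg hx, Set.indicator_of_notMem hx, Pi.zero_apply]
    rw [this]
    exact (hM.measurable _).measurable_mk.indicator hS
  refine ⟨?_, hcont, fun x => ?_, fun x ξ => ?_, fun x => ?_⟩
  · exact (measurable_uncurry_of_continuous_of_measurable
      (u := fun ξ x => (if x ∈ Ω ∩ tᶜ then M x else 0) ξ) hcont hmeas).comp measurable_swap
  all_goals split_ifs with hx
  · exact ((hgood x hx).2.1 0).2 rfl
  · rfl
  · exact (hgood x hx).2.2.1 ξ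
  · rfl
  · exact (hgood x hx).2.2.2.1
  · exact convexOn_const 0 convex_univ

namespace IsConvexIntegrand

theorem nonneg (hM : IsConvexIntegrand M) (x ξ : RN N) : 0 ≤ M x ξ := by
  have := (hM.convex x).2 (Set.mem_univ ξ) (Set.mem_univ (-ξ)) 
    (by norm_num : (0 : ℝ) ≤ 1 / 2) (by norm_num : (0 : ℝ) ≤ 1 / 2) (by norm_num)
  rw [smul_neg, add_neg_cancel, hM.zero, hM.even, smul_eq_mul] at this
  linarith

theorem smul_le (hM : IsConvexIntegrand M) (x ξ : RN N) {t : ℝ} (ht0 : 0 ≤ t) (ht1 : t ≤ 1) :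
    M x (t • ξ) ≤ M x ξ := by
  have := (hM.convex x).2 (Set.mem_univ ξ) (Set.mem_univ 0) 
    ht0 (sub_nonneg.2 ht1) (by ring)
  rw [smul_zero, add_zero, hM.zero, smul_zero, add_zero, smul_eq_mul] at this
  nlinarith [hM.nonneg x ξ]

theorem smul_le_smul (hM : IsConvexIntegrand M) (x ξ : RN N) {s t : ℝ} (h : |s| ≤ |t|) :
    M x (s • ξ) ≤ M x (t • ξ) := by
  have habs : ∀ r : ℝ, M x (|r| • ξ) = M x (r • ξ) := fun r => by
    rcases abs_choice r with h | h <;> rw [h]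
    rw [neg_smul, hM.even]
  rw [← habs s, ← habs t]
  rcases (abs_nonneg t).eq_or_lt with h0 | h0
  · rw [← h0] at h ⊢
    rw [le_antisymm h (abs_nonneg s)]
  · have := hM.smul_le x (|t| • ξ) (t := |s| / |t|) (by positivity) ((div_le_one h0).2 h)
    rwa [smul_smul, div_mul_cancel₀ _ h0.ne'] at this

/-- Convexity at the midpoint with the factor 1/2 on the right discarded. It replaces a triangle
inequality: each sum costs a halving of the scale, the source of the shrinking scales below. -/
theorem half_add_le (hM : IsConvexIntegrand M) (x ξ ζ : RN N) :
    M x ((2 : ℝ)⁻¹ • (ξ + ζ)) ≤ M x ξ + M x ζ := by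
  have := (hM.convex x).2 (Set.mem_univ ξ) (Set.mem_univ ζ) 
    (by norm_num : (0 : ℝ) ≤ 2⁻¹) (by norm_num : (0 : ℝ) ≤ 2⁻¹) (by norm_num)
  rw [← smul_add, smul_eq_mul, smul_eq_mul] at this
  linarith [hM.nonneg x ξ, hM.nonneg x ζ]

theorem aemeasurable_comp (hM : IsConvexIntegrand M) {μ : Measure (RN N)} {ξ : RN N → RN N}
    (hξ : AEMeasurable ξ μ) : AEMeasurable (fun x => M x (ξ x)) μ :=
  hM.measurable.comp_aemeasurable (aemeasurable_id.prodMk hξ)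

theorem modular_half_add_le (hM : IsConvexIntegrand M) {ξ ζ : RN N → RN N}
    (hξ : AEStronglyMeasurable ξ (volume.restrict Ω)) :
    modular Ω M (fun x => (2 : ℝ)⁻¹ • (ξ x + ζ x)) ≤ modular Ω M ξ + modular Ω M ζ := by
  unfold modular
  rw [← lintegral_add_left' (hM.aemeasurable_comp hξ.aemeasurable).ennreal_ofReal]
  refine lintegral_mono fun x => ?_
  rw [← ENNReal.ofReal_add (hM.nonneg _ _) (hM.nonneg _ _)]
  exact ENNReal.ofReal_le_ofReal (hM.half_add_le _ _ _)

theorem modular_smul_le (hM : IsConvexIntegrand M) (ξ : RN N → RN N) {s t : ℝ} (h : |s| ≤ |t|) :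
    modular Ω M (fun x => s • ξ x) ≤ modular Ω M (fun x => t • ξ x) :=
  lintegral_mono fun _ => ENNReal.ofReal_le_ofReal (hM.smul_le_smul _ _ h)

/-- Membership in the Musielak-Orlicz space: some positive multiple has finite modular. -/
theorem mem_orliczSpace_iff (hM : IsConvexIntegrand M) {ξ : RN N → RN N} :
    ξ ∈ orliczSpace Ω M ↔ AEStronglyMeasurable ξ (volume.restrict Ω) ∧
      ∃ t > (0 : ℝ), modular Ω M (fun x => t • ξ x) < ⊤ := by
  constructor
  · intro h
    induction h using Submodule.span_induction with
    | mem ξ h => exact ⟨h.1, 1, one_pos, by simpa using h.2⟩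
    | zero => exact ⟨aestronglyMeasurable_zero, 1, one_pos, by simp [modular, hM.zero]⟩
    | add ξ ζ _ _ h1 h2 =>
      obtain ⟨h1, s, hs, hs'⟩ := h1
      obtain ⟨h2, t, ht, ht'⟩ := h2
      refine ⟨h1.add h2, 2⁻¹ * min s t, by positivity, ?_⟩
      have h0 : 0 < min s t := lt_min hs ht
      have := hM.modular_half_add_le (Ω := Ω) (ξ := fun x => min s t • ξ x)
        (ζ := fun x => min s t • ζ x) (h1.const_smul (min s t))
      simp only [Pi.add_apply, mul_smul, smul_add] at this ⊢
      refine this.trans_lt (ENNReal.add_lt_top.2 ⟨?_, ?_⟩)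
      · refine (hM.modular_smul_le ξ ?_).trans_lt hs'
        rw [abs_of_pos h0, abs_of_pos hs]
        exact min_le_left _ _
      · refine (hM.modular_smul_le ζ ?_).trans_lt ht'
        rw [abs_of_pos h0, abs_of_pos ht]
        exact min_le_right _ _
    | smul a ξ _ h =>
      obtain ⟨h, s, hs, hs'⟩ := h
      refine ⟨h.const_smul a, s / (1 + |a|), by positivity, ?_⟩
      simp only [Pi.smul_apply, smul_smul]
      refine (hM.modular_smul_le ξ ?_).trans_lt hs'
      rw [abs_mul, abs_div, abs_of_pos hs, abs_of_pos (by positivity : 0 < 1 + |a|),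
        div_mul_eq_mul_div, div_le_iff₀ (by positivity)]
      nlinarith [abs_nonneg a]
  · rintro ⟨h, t, ht, ht'⟩
    have : ξ = t⁻¹ • (t • ξ) := by rw [smul_smul, inv_mul_cancel₀ ht.ne', one_smul]
    rw [this]
    exact Submodule.smul_mem _ _ (Submodule.subset_span ⟨h.const_smul t, ht'⟩)

/-- A vector is the average of the N axial vectors N ξ_i e_i, so convexity and evenness reduce a
bounded field to the constants N K e_i, whose modulars are finite. This handles the term φ∇θ and the
gradients of test functions. -/
theorem modular_lt_top_of_bounded (hM : IsConvexIntegrand M)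
    (hint : ∀ z, ∫⁻ x in Ω, ENNReal.ofReal (M x z) < ⊤) {ξ : RN N → RN N} {K : ℝ}
    (hK : ∀ᵐ x ∂(volume.restrict Ω), ‖ξ x‖ ≤ K) : modular Ω M ξ < ⊤ := by
  let e : Fin N → RN N := fun i => EuclideanSpace.single i (1 : ℝ)
  have key : ∀ᵐ x ∂(volume.restrict Ω), ENNReal.ofReal (M x (ξ x)) ≤
      ∑ i, ENNReal.ofReal (M x ((N * K) • e i)) := by
    filter_upwards [hK] with x hx
    rw [← ENNReal.ofReal_sum_of_nonneg fun i _ => hM.nonneg _ _]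
    refine ENNReal.ofReal_le_ofReal ?_
    rcases Nat.eq_zero_or_pos N with h0 | h0
    · subst h0
      rw [Subsingleton.elim (ξ x) 0, hM.zero]
      exact Finset.sum_nonneg fun i _ => hM.nonneg _ _
    have hN : (0 : ℝ) < N := by exact_mod_cast h0
    have hsum : ξ x = ∑ i, (N : ℝ)⁻¹ • ((N * ξ x i) • e i) := by
      ext j
      simp [e, Pi.single_apply, hN.ne']
    have h1 : M x (ξ x) ≤ ∑ i, (N : ℝ)⁻¹ • M x ((N * ξ x i) • e i) := by
      conv_lhs => rw [hsum]
      refine (hM.convex x).map_sum_le (fun i _ => by positivity) ?_ fun i _ => Set.mem_univ _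
      simp [hN.ne']
    refine h1.trans (Finset.sum_le_sum fun i _ => ?_)
    have h2 : M x ((N * ξ x i) • e i) ≤ M x ((N * K) • e i) := by
      refine hM.smul_le_smul x _ ?_
      have h3 : |ξ x i| ≤ K := (PiLp.norm_apply_le (ξ x) i).trans hx
      rw [abs_mul, abs_mul]
      exact mul_le_mul_of_nonneg_left (h3.trans (le_abs_self K)) (abs_nonneg _)
    have h3 : (N : ℝ)⁻¹ ≤ 1 := inv_le_one_of_one_le₀ (by exact_mod_cast h0)
    rw [smul_eq_mul]
    nlinarith [hM.nonneg x ((N * ξ x i) • e i)]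
  refine (lintegral_mono_ae key).trans_lt ?_
  rw [lintegral_finsetSum' _ fun i _ =>
    (hM.aemeasurable_comp aemeasurable_const).ennreal_ofReal]
  exact ENNReal.sum_lt_top.2 fun i _ => hint _

end IsConvexIntegrand

end MusielakOrlicz

/-! ### Weak gradients, extension by zero and the product rule -/

namespace MusielakOrlicz

variable {N : ℕ} {Ω : Set (RN N)}

theorem gradient_apply (ψ : RN N → ℝ) (x : RN N) (i : Fin N) :
    gradient ψ x i = fderiv ℝ ψ x (EuclideanSpace.single i 1) := by
  rw [← inner_gradient_left, EuclideanSpace.inner_single_right]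
  simp

theorem norm_gradient (ψ : RN N → ℝ) (x : RN N) : ‖gradient ψ x‖ = ‖fderiv ℝ ψ x‖ := by
  rw [← toDual_gradient, LinearIsometryEquiv.norm_map]

theorem continuous_gradient {ψ : RN N → ℝ} (h : ContDiff ℝ ∞ ψ) : Continuous (gradient ψ) :=
  (LinearIsometryEquiv.continuous _).comp (h.continuous_fderiv (by simp))

theorem hasCompactSupport_gradient {ψ : RN N → ℝ} (h : HasCompactSupport ψ) :
    HasCompactSupport (gradient ψ) :=
  (h.fderiv ℝ).comp_left (g := (InnerProductSpace.toDual ℝ (RN N)).symm) (map_zero _)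

theorem exists_bound_of_hasCompactSupport {E : Type*} [NormedAddCommGroup E] {f : RN N → E}
    (hf : Continuous f) (h : HasCompactSupport f) : ∃ C, 0 ≤ C ∧ ∀ x, ‖f x‖ ≤ C := by
  obtain ⟨C, hC⟩ := hf.bounded_above_of_compact_support h
  exact ⟨C, (norm_nonneg _).trans (hC 0), hC⟩

theorem abs_apply_le (x : RN N) (i : Fin N) : |x i| ≤ ‖x‖ := PiLp.norm_apply_le x i

theorem integrable_apply {μ : Measure (RN N)} {g : RN N → RN N} (hg : Integrable g μ) (i : Fin N) :
    Integrable (fun x => g x i) μ :=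
  (EuclideanSpace.proj (𝕜 := ℝ) i).integrable_comp hg

theorem integral_apply {μ : Measure (RN N)} {g : RN N → RN N} (hg : Integrable g μ) (i : Fin N) :
    (∫ x, g x ∂μ) i = ∫ x, g x i ∂μ :=
  ((EuclideanSpace.proj (𝕜 := ℝ) i).integral_comp_comm hg).symm

theorem integrable_mul_of_bounded {μ : Measure (RN N)} {f ψ : RN N → ℝ} (hf : Integrable f μ)
    (hψ : Continuous ψ) {C : ℝ} (hC : ∀ x, |ψ x| ≤ C) : Integrable (fun x => f x * ψ x) μ :=
  hf.mul_bdd (c := C) hψ.aestronglyMeasurable (ae_of_all _ hC)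

/-- The fundamental lemma of the calculus of variations. It identifies the gradients that occur
separately in the W_0^{1,1} condition, in the V_0^M condition and in the conclusion. -/
theorem IsWeakGradient.ae_eq (hΩ : IsOpen Ω) {u : RN N → ℝ} {g g' : RN N → RN N}
    (hg : IsWeakGradient Ω u g) (hg' : IsWeakGradient Ω u g') :
    g =ᵐ[volume.restrict Ω] g' := by
  have hint : ∀ {g : RN N → RN N}, LocallyIntegrableOn g Ω → ∀ ψ : RN N → ℝ, ContDiff ℝ ∞ ψ →
      HasCompactSupport ψ → tsupport ψ ⊆ Ω → Integrable (fun x => ψ x • g x) := by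
    intro g hg ψ h1 h2 h3
    have hK : IntegrableOn g (tsupport ψ) := hg.integrableOn_compact_subset h3 h2
    obtain ⟨C, _, hC⟩ := exists_bound_of_hasCompactSupport h1.continuous h2
    have : IntegrableOn (fun x => ψ x • g x) (tsupport ψ) :=
      hK.bdd_smul C h1.continuous.aestronglyMeasurable (ae_of_all _ hC)
    exact (integrableOn_iff_integrable_of_support_subset
      ((Function.support_smul_subset_left ψ g).trans (subset_tsupport ψ))).1 this
  have key : ∀ᵐ x, x ∈ Ω → (g x - g' x) = 0 := by
    refine hΩ.ae_eq_zero_of_integral_contDiff_smul_eq_zero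
      (hg.grad_locallyIntegrableOn.sub hg'.grad_locallyIntegrableOn) fun ψ h1 h2 h3 => ?_
    have i1 := hint hg.grad_locallyIntegrableOn ψ h1 h2 h3
    have i2 := hint hg'.grad_locallyIntegrableOn ψ h1 h2 h3
    have hset : ∀ g : RN N → RN N, ∀ i, ∫ x in Ω, g x i * ψ x = ∫ x, (ψ x • g x) i := by
      intro g i
      rw [setIntegral_eq_integral_of_forall_compl_eq_zero]
      · exact integral_congr_ae (ae_of_all _ fun x => by simp [mul_comm])
      · intro x hx
        rw [image_eq_zero_of_notMem_tsupport fun h => hx (h3 h), mul_zero]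
    simp only [smul_sub]
    rw [integral_sub i1 i2]
    ext i
    have e1 := hg.integral_eq ψ ⟨h1, h2, h3⟩ i
    have e2 := hg'.integral_eq ψ ⟨h1, h2, h3⟩ i
    rw [hset] at e1 e2
    rw [PiLp.sub_apply, integral_apply i1, integral_apply i2, PiLp.zero_apply]
    linarith
  filter_upwards [(ae_restrict_iff' hΩ.measurableSet).2 key] with x hx using sub_eq_zero.1 hx

/-- `G` is the weak gradient of `u` on the whole space. -/
def HasWeakGradient (u : RN N → ℝ) (G : RN N → RN N) : Prop :=
  ∀ ψ : RN N → ℝ, ContDiff ℝ ∞ ψ → HasCompactSupport ψ → ∀ i : Fin N,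
    ∫ x, u x * gradient ψ x i = - ∫ x, G x i * ψ x

theorem hasWeakGradient_gradient {f : RN N → ℝ} (hf : ContDiff ℝ ∞ f) (hfc : HasCompactSupport f) :
    HasWeakGradient f (gradient f) := by
  intro ψ h1 h2 i
  simp only [gradient_apply]
  have c1 := h1.continuous_fderiv (by simp)
  have c2 := hf.continuous_fderiv (by simp)
  refine integral_mul_fderiv_eq_neg_fderiv_mul_of_integrable
    (Continuous.integrable_of_hasCompactSupport ?_ h2.mul_left)
    (Continuous.integrable_of_hasCompactSupport ?_ hfc.mul_right)
    (Continuous.integrable_of_hasCompactSupport (hf.continuous.mul h1.continuous) hfc.mul_right)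
    (fun x _ => hf.differentiable (by simp) x) (fun x _ => h1.differentiable (by simp) x)
  · exact (c2.clm_apply continuous_const).mul h1.continuous
  · exact hf.continuous.mul (c1.clm_apply continuous_const)

theorem gradient_eq_zero_of_notMem {f : RN N → ℝ} {x : RN N} (hx : x ∉ tsupport f) :
    gradient f x = 0 := by
  have : fderiv ℝ f x = 0 := by
    by_contra h
    exact hx (support_fderiv_subset ℝ (f := f) h)
  rw [← norm_eq_zero, norm_gradient, this, norm_zero]

/-- The extension by zero of a function in `W_0^{1,1}(Ω)` is weakly differentiable on `ℝ^N`. -/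
theorem MemW011.hasWeakGradient_indicator (hΩ : IsOpen Ω) {φ : RN N → ℝ} (hφ : MemW011 Ω φ)
    {g : RN N → RN N} (hg : IsWeakGradient Ω φ g) :
    IntegrableOn φ Ω ∧ IntegrableOn g Ω ∧ HasWeakGradient (Ω.indicator φ) (Ω.indicator g) := by
  obtain ⟨g₀, hg₀, iφ, ig₀, happ⟩ := hφ
  have hae := hg₀.ae_eq hΩ hg
  have ig : IntegrableOn g Ω := ig₀.congr hae
  refine ⟨iφ, ig, fun ψ h1 h2 i => ?_⟩
  have e1 : ∫ x, Ω.indicator φ x * gradient ψ x i = ∫ x in Ω, φ x * gradient ψ x i := by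
    rw [← integral_indicator hΩ.measurableSet]
    exact integral_congr_ae (ae_of_all _ fun x => by by_cases hx : x ∈ Ω <;> simp [hx])
  have e2 : ∫ x, Ω.indicator g x i * ψ x = ∫ x in Ω, g₀ x i * ψ x := by
    have : ∫ x in Ω, g₀ x i * ψ x = ∫ x in Ω, g x i * ψ x :=
      integral_congr_ae (by filter_upwards [hae] with x hx; rw [hx])
    rw [this, ← integral_indicator hΩ.measurableSet]
    exact integral_congr_ae (ae_of_all _ fun x => by by_cases hx : x ∈ Ω <;> simp [hx])
  rw [e1, e2, ← add_eq_zero_iff_eq_neg]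
  obtain ⟨C, hC0, hC⟩ := exists_bound_of_hasCompactSupport (continuous_gradient h1)
    (hasCompactSupport_gradient h2)
  obtain ⟨D, hD0, hD⟩ := exists_bound_of_hasCompactSupport h1.continuous h2
  have cg : Continuous fun x => gradient ψ x i :=
    (EuclideanSpace.proj (𝕜 := ℝ) i).continuous.comp (continuous_gradient h1)
  have hC' : ∀ x, |gradient ψ x i| ≤ C := fun x => (abs_apply_le _ i).trans (hC x)
  set J := ∫ x in Ω, φ x * gradient ψ x i with hJ
  set J' := ∫ x in Ω, g₀ x i * ψ x with hJ'
  -- The sum of the two integrals vanishes when φ is a test function on Ω, and it is continuous in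
  -- the W^{1,1} norm even though ψ need not vanish near the boundary.
  have bound : ∀ ε : ℝ, 0 < ε → |J + J'| ≤ (C + D) * ε := by
    intro ε hε
    obtain ⟨f, hf, hlt⟩ := happ (ENNReal.ofReal ε) (by simpa using hε)
    have if_ : Integrable f := hf.smooth.continuous.integrable_of_hasCompactSupport hf.compact_support
    have igf : Integrable (gradient f) :=
      (continuous_gradient hf.smooth).integrable_of_hasCompactSupport
        (hasCompactSupport_gradient hf.compact_support)
    have hw := hasWeakGradient_gradient hf.smooth hf.compact_support ψ h1 h2 i
    rw [← setIntegral_eq_integral_of_forall_compl_eq_zero (s := Ω),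
      ← setIntegral_eq_integral_of_forall_compl_eq_zero (s := Ω)
        (f := fun x => gradient f x i * ψ x)] at hw
    rotate_left
    · intro x hx
      rw [gradient_eq_zero_of_notMem fun h => hx (hf.support_subset h)]
      simp
    · intro x hx
      rw [image_eq_zero_of_notMem_tsupport fun h => hx (hf.support_subset h), zero_mul]
    have d1 : Integrable (fun x => φ x - f x) (volume.restrict Ω) := iφ.sub if_.integrableOn
    have d2 : Integrable (fun x => g₀ x - gradient f x) (volume.restrict Ω) :=
      ig₀.sub igf.integrableOn
    have s1 : J - ∫ x in Ω, f x * gradient ψ x i = ∫ x in Ω, (φ x - f x) * gradient ψ x i := by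
      rw [hJ, ← integral_sub (integrable_mul_of_bounded iφ cg hC')
        (integrable_mul_of_bounded if_.integrableOn cg hC')]
      simp only [sub_mul]
    have s2 : J' - ∫ x in Ω, gradient f x i * ψ x =
        ∫ x in Ω, (g₀ x - gradient f x) i * ψ x := by
      rw [hJ', ← integral_sub (integrable_mul_of_bounded (integrable_apply ig₀ i) h1.continuous hD)
        (integrable_mul_of_bounded (integrable_apply igf.integrableOn i) h1.continuous hD)]
      simp only [PiLp.sub_apply, sub_mul]
    have n1 : ∫ x in Ω, ‖φ x - f x‖ ≤ ε := by
      rw [integral_norm_eq_lintegral_enorm d1.aestronglyMeasurable, ← eLpNorm_one_eq_lintegral_enorm]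
      exact ENNReal.toReal_le_of_le_ofReal hε.le (le_self_add.trans hlt.le)
    have n2 : ∫ x in Ω, ‖g₀ x - gradient f x‖ ≤ ε := by
      rw [integral_norm_eq_lintegral_enorm d2.aestronglyMeasurable, ← eLpNorm_one_eq_lintegral_enorm]
      exact ENNReal.toReal_le_of_le_ofReal hε.le (le_add_self.trans hlt.le)
    have b1 : |∫ x in Ω, (φ x - f x) * gradient ψ x i| ≤ C * ε := by
      rw [← Real.norm_eq_abs]
      refine (norm_integral_le_of_norm_le (d1.norm.const_mul C) (ae_of_all _ fun x => ?_)).trans ?_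
      · rw [norm_mul, mul_comm]
        exact mul_le_mul_of_nonneg_right (hC' x) (norm_nonneg _)
      · rw [integral_const_mul]
        exact mul_le_mul_of_nonneg_left n1 hC0
    have b2 : |∫ x in Ω, (g₀ x - gradient f x) i * ψ x| ≤ D * ε := by
      rw [← Real.norm_eq_abs]
      refine (norm_integral_le_of_norm_le (d2.norm.const_mul D) (ae_of_all _ fun x => ?_)).trans ?_
      · rw [norm_mul, mul_comm]
        exact mul_le_mul (hD x) (abs_apply_le _ i) (norm_nonneg _) hD0
      · rw [integral_const_mul]
        exact mul_le_mul_of_nonneg_left n2 hD0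
    have : J + J' = (∫ x in Ω, (φ x - f x) * gradient ψ x i) +
        ∫ x in Ω, (g₀ x - gradient f x) i * ψ x := by
      rw [← s1, ← s2, hw]
      ring
    rw [this]
    refine (abs_add_le _ _).trans ?_
    linarith
  by_contra hne
  have hpos : 0 < |J + J'| := abs_pos.2 hne
  have := bound (|J + J'| / (2 * (C + D + 1))) (by positivity)
  rw [mul_div_assoc', le_div_iff₀ (by positivity)] at this
  nlinarith

theorem gradient_mul {f h : RN N → ℝ} {x : RN N} (hf : DifferentiableAt ℝ f x)
    (hh : DifferentiableAt ℝ h x) :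
    gradient (fun y => f y * h y) x = f x • gradient h x + h x • gradient f x := by
  ext i
  simp only [PiLp.add_apply, PiLp.smul_apply, gradient_apply, smul_eq_mul]
  rw [fderiv_fun_mul hf hh]
  simp

/-- The product rule for a smooth factor. -/
theorem HasWeakGradient.smooth_mul {u : RN N → ℝ} {G : RN N → RN N} (h : HasWeakGradient u G)
    (hu : Integrable u) (hG : Integrable G) {θ : RN N → ℝ} (hθ : ContDiff ℝ ∞ θ) :
    HasWeakGradient (fun x => θ x * u x) (fun x => θ x • G x + u x • gradient θ x) := by
  intro ψ h1 h2 i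
  have hsm : ContDiff ℝ ∞ fun x => θ x * ψ x := hθ.mul h1
  have hcs : HasCompactSupport fun x => θ x * ψ x := h2.mul_left
  have hw := h _ hsm hcs i
  have cgi : ∀ {f : RN N → ℝ}, ContDiff ℝ ∞ f → Continuous fun x => gradient f x i := fun hf =>
    (EuclideanSpace.proj (𝕜 := ℝ) i).continuous.comp (continuous_gradient hf)
  have hint : ∀ {v w : RN N → ℝ}, Integrable v → Continuous w → HasCompactSupport w →
      Integrable fun x => v x * w x := by
    intro v w hv hw hwc
    obtain ⟨C, _, hC⟩ := exists_bound_of_hasCompactSupport hw hwc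
    exact integrable_mul_of_bounded hv hw hC
  have cs : HasCompactSupport fun x => gradient ψ x i :=
    (hasCompactSupport_gradient h2).comp_left (g := fun y : RN N => y i) rfl
  have i1 : Integrable fun x => u x * (θ x * gradient ψ x i) :=
    hint hu (hθ.continuous.mul (cgi h1)) cs.mul_left
  have i2 : Integrable fun x => u x * (gradient θ x i * ψ x) :=
    hint hu ((cgi hθ).mul h1.continuous) h2.mul_left
  have i3 : Integrable fun x => G x i * (θ x * ψ x) :=
    hint (integrable_apply hG i) hsm.continuous hcs
  have e1 : ∫ x, u x * gradient (fun x => θ x * ψ x) x i =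
      (∫ x, u x * (θ x * gradient ψ x i)) + ∫ x, u x * (gradient θ x i * ψ x) := by
    rw [← integral_add i1 i2]
    refine integral_congr_ae (ae_of_all _ fun x => ?_)
    dsimp only
    rw [gradient_mul (hθ.differentiable (by simp) x) (h1.differentiable (by simp) x)]
    simp only [PiLp.add_apply, PiLp.smul_apply, smul_eq_mul]
    ring
  have e2 : ∫ x, (θ x • G x + u x • gradient θ x) i * ψ x =
      (∫ x, G x i * (θ x * ψ x)) + ∫ x, u x * (gradient θ x i * ψ x) := by
    rw [← integral_add i3 i2]
    refine integral_congr_ae (ae_of_all _ fun x => ?_)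
    simp only [PiLp.add_apply, PiLp.smul_apply, smul_eq_mul]
    ring
  have e3 : ∫ x, θ x * u x * gradient ψ x i = ∫ x, u x * (θ x * gradient ψ x i) :=
    integral_congr_ae (ae_of_all _ fun x => by ring)
  rw [e2, e3]
  rw [e1] at hw
  linarith

end MusielakOrlicz

/-! ### Shifted mollifiers -/

namespace MusielakOrlicz

variable {N : ℕ} {Ω : Set (RN N)}

/-- A smooth probability density supported in the ball of radius `κ δ` about `δ v`, whose gradient
has `L¹`-norm at most `C / δ`. -/
structure IsMollifier (v : RN N) (κ C δ : ℝ) (η : RN N → ℝ) : Prop where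
  smooth : ContDiff ℝ ∞ η
  compact_support : HasCompactSupport η
  nonneg : ∀ y, 0 ≤ η y
  integral_eq : ∫ y, η y = 1
  support : ∀ y, η y ≠ 0 → ‖y - δ • v‖ ≤ κ * δ
  integral_fderiv : ∫ y, ‖fderiv ℝ η y‖ ≤ C / δ

theorem exists_isMollifier (v : RN N) {κ : ℝ} (hκ : 0 < κ) :
    ∃ (C : ℝ) (η : ℝ → RN N → ℝ), ∀ δ, 0 < δ → IsMollifier v κ C δ (η δ) := by
  -- A bump centred at v rather than 0: the dilation by δ carries its centre to δv. The constant C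
  -- is the L¹ norm of the undilated derivative.
  let f : ContDiffBump v := ⟨κ / 2, κ, by positivity, by linarith⟩
  have hf : ContDiff ℝ ∞ (f.normed volume) := f.contDiff_normed
  have hcomp : ∀ δ : ℝ, 0 < δ → HasCompactSupport fun y : RN N => f.normed volume (δ⁻¹ • y) :=
    fun δ hδ => f.hasCompactSupport_normed.comp_smul (inv_ne_zero hδ.ne')
  refine ⟨∫ y, ‖fderiv ℝ (f.normed volume) y‖, fun δ y => (δ ^ N)⁻¹ * f.normed volume (δ⁻¹ • y),
    fun δ hδ => ⟨?_, ?_, fun y => ?_, ?_, fun y hy => ?_, ?_⟩⟩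
  · exact contDiff_const.mul (hf.comp (contDiff_const_smul _))
  · exact (hcomp δ hδ).mul_left
  · exact mul_nonneg (by positivity) (f.nonneg_normed _)
  · rw [integral_const_mul, Measure.integral_comp_inv_smul_of_nonneg volume _ hδ.le,
      f.integral_normed, finrank_euclideanSpace_fin, smul_eq_mul, mul_one,
      inv_mul_cancel₀ (by positivity)]
  · have h1 : δ⁻¹ • y ∈ Function.support (f.normed volume) := fun h => hy (by dsimp only; rw [h, mul_zero])
    rw [f.support_normed_eq, mem_ball_iff_norm] at h1
    have h2 : y - δ • v = δ • (δ⁻¹ • y - v) := by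
      rw [smul_sub, smul_smul, mul_inv_cancel₀ hδ.ne', one_smul]
    rw [h2, norm_smul, Real.norm_of_nonneg hδ.le, mul_comm]
    exact mul_le_mul_of_nonneg_right h1.le hδ.le
  · have h1 : ∀ y, ‖fderiv ℝ (fun y => (δ ^ N)⁻¹ * f.normed volume (δ⁻¹ • y)) y‖ =
        ((δ ^ N)⁻¹ * δ⁻¹) * ‖fderiv ℝ (f.normed volume) (δ⁻¹ • y)‖ := by
      intro y
      have hd : HasFDerivAt (f.normed volume) (fderiv ℝ (f.normed volume) (δ⁻¹ • y)) (δ⁻¹ • y) :=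
        (hf.differentiable (by simp) _).hasFDerivAt
      have hs : HasFDerivAt (fun y : RN N => δ⁻¹ • y) (δ⁻¹ • ContinuousLinearMap.id ℝ (RN N)) y :=
        (hasFDerivAt_id y).const_smul δ⁻¹
      have h2 : fderiv ℝ (fun y => (δ ^ N)⁻¹ * f.normed volume (δ⁻¹ • y)) y = _ :=
        ((hd.comp y hs).const_mul (δ ^ N)⁻¹).fderiv
      rw [h2, ContinuousLinearMap.comp_smul, ContinuousLinearMap.comp_id, smul_smul, norm_smul,
        Real.norm_of_nonneg (by positivity)]
    simp only [h1]
    rw [integral_const_mul, Measure.integral_comp_inv_smul_of_nonneg volume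
        (fun y => ‖fderiv ℝ (f.normed volume) y‖) hδ.le,
      finrank_euclideanSpace_fin, smul_eq_mul]
    refine le_of_eq ?_
    field_simp

/-- The convolution `η * f`. -/
noncomputable def average {E : Type*} [NormedAddCommGroup E] [NormedSpace ℝ E] (η : RN N → ℝ)
    (f : RN N → E) (x : RN N) : E :=
  ∫ y, η y • f (x - y)

section average

variable {v : RN N} {κ C δ : ℝ} {η : RN N → ℝ} {E : Type*} [NormedAddCommGroup E] [NormedSpace ℝ E]

theorem average_eq_convolution (η : RN N → ℝ) (f : RN N → E) :
    average η f = convolution η f (ContinuousLinearMap.lsmul ℝ ℝ) volume := rfl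

theorem IsMollifier.integrable_smul (hη : IsMollifier v κ C δ η) {f : RN N → E}
    (hf : Integrable f) (x : RN N) : Integrable fun y => η y • f (x - y) :=
  hη.compact_support.convolutionExists_left (ContinuousLinearMap.lsmul ℝ ℝ) hη.smooth.continuous
    hf.locallyIntegrable x

theorem IsMollifier.contDiff_average (hη : IsMollifier v κ C δ η) {u : RN N → ℝ}
    (hu : Integrable u) : ContDiff ℝ ∞ (average η u) := by
  rw [average_eq_convolution]
  exact hη.compact_support.contDiff_convolution_left _ hη.smooth hu.locallyIntegrable

theorem IsMollifier.support_average (hη : IsMollifier v κ C δ η) {u : RN N → ℝ} {K : Set (RN N)}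
    (hu : ∀ x ∉ K, u x = 0) {x : RN N} (hx : average η u x ≠ 0) :
    ∃ y ∈ K, ‖x - y - δ • v‖ ≤ κ * δ := by
  by_contra! h
  refine hx (integral_eq_zero_of_ae (ae_of_all _ fun y => ?_))
  by_cases h1 : x - y ∈ K
  · have h2 := h _ h1
    rw [sub_sub_cancel] at h2
    have h3 : η y = 0 := by
      by_contra h0
      exact absurd (hη.support y h0) (not_le.2 h2)
    simp [h3]
  · simp [hu _ h1]

theorem IsMollifier.hasFDerivAt_average (hη : IsMollifier v κ C δ η) {u : RN N → ℝ}
    (hu : Integrable u) (x : RN N) :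
    HasFDerivAt (average η u) (convolution (fderiv ℝ η) u
      ((ContinuousLinearMap.lsmul ℝ ℝ : ℝ →L[ℝ] ℝ →L[ℝ] ℝ).precompL (RN N)) volume x) x := by
  rw [average_eq_convolution]
  exact hη.compact_support.hasFDerivAt_convolution_left _ (hη.smooth.of_le (by simp))
    hu.locallyIntegrable x

theorem ae_comp_sub_left {p : RN N → Prop} (h : ∀ᵐ x, p x) (x : RN N) :
    ∀ᵐ y, p (x - y) :=
  (quasiMeasurePreserving_sub_left_of_right_invariant volume x).ae h

/-- All derivatives fall on the kernel, so only the sup bound of u enters. The resulting order 1/δ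
is what the exponent in condition (M) can absorb. -/
theorem IsMollifier.norm_gradient_average_le (hη : IsMollifier v κ C δ η) {u : RN N → ℝ}
    (hu : Integrable u) {K : ℝ} (hK0 : 0 ≤ K) (hK : ∀ᵐ x, |u x| ≤ K) (x : RN N) :
    ‖gradient (average η u) x‖ ≤ K * (C / δ) := by
  have cf : Continuous (fderiv ℝ η) := hη.smooth.continuous_fderiv (by simp)
  have hi : Integrable fun y => ‖fderiv ℝ η y‖ :=
    (cf.integrable_of_hasCompactSupport (hη.compact_support.fderiv ℝ)).norm
  rw [norm_gradient, (hη.hasFDerivAt_average hu x).fderiv, convolution_def]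
  refine (norm_integral_le_of_norm_le (hi.const_mul K) ?_).trans ?_
  · filter_upwards [ae_comp_sub_left hK x] with y hy
    refine ContinuousLinearMap.opNorm_le_bound _ (by positivity) fun w => ?_
    rw [ContinuousLinearMap.precompL_apply, ContinuousLinearMap.lsmul_apply, norm_smul]
    calc ‖fderiv ℝ η y w‖ * ‖u (x - y)‖ ≤ (‖fderiv ℝ η y‖ * ‖w‖) * K :=
          mul_le_mul (ContinuousLinearMap.le_opNorm _ _) hy (norm_nonneg _) (by positivity)
      _ = _ := by ring
  · rw [integral_const_mul]
    exact mul_le_mul_of_nonneg_left hη.integral_fderiv hK0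

/-- The weak gradient identity is tested with t ↦ η(x - t), followed by the substitution t ↦ x - t.
-/
theorem IsMollifier.gradient_average (hη : IsMollifier v κ C δ η) {u : RN N → ℝ} {G : RN N → RN N}
    (hu : Integrable u) (hG : Integrable G) (hw : HasWeakGradient u G) (x : RN N) :
    gradient (average η u) x = average η G x := by
  ext i
  have cf : Continuous (fderiv ℝ η) := hη.smooth.continuous_fderiv (by simp)
  have hint : Integrable fun t => ((ContinuousLinearMap.lsmul ℝ ℝ : ℝ →L[ℝ] ℝ →L[ℝ] ℝ).precompL
      (RN N)) (fderiv ℝ η t) (u (x - t)) :=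
    (hη.compact_support.fderiv ℝ).convolutionExists_left _ cf hu.locallyIntegrable x
  rw [gradient_apply, (hη.hasFDerivAt_average hu x).fderiv, convolution_def,
    ContinuousLinearMap.integral_apply hint, average, integral_apply (hη.integrable_smul hG x)]
  have hψ : ContDiff ℝ ∞ fun t => η (x - t) := hη.smooth.comp (contDiff_const.sub contDiff_id)
  have hψc : HasCompactSupport fun t => η (x - t) :=
    hη.compact_support.comp_homeomorph (Homeomorph.subLeft x)
  have hd : ∀ t, gradient (fun t => η (x - t)) t i =
      -fderiv ℝ η (x - t) (EuclideanSpace.single i 1) := by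
    intro t
    rw [gradient_apply]
    have h1 : HasFDerivAt η (fderiv ℝ η (x - t)) (x - t) :=
      (hη.smooth.differentiable (by simp) _).hasFDerivAt
    have h2 : HasFDerivAt (fun t : RN N => x - t) (-ContinuousLinearMap.id ℝ (RN N)) t :=
      (hasFDerivAt_id t).const_sub x
    have h3 : fderiv ℝ (fun t => η (x - t)) t = _ := (h1.comp t h2).fderiv
    rw [h3]
    simp
  have key := hw _ hψ hψc i
  simp only [hd, mul_neg, integral_neg, neg_inj] at key
  rw [← integral_sub_left_eq_self (fun t => u t * fderiv ℝ η (x - t) (EuclideanSpace.single i 1))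
      volume x, ← integral_sub_left_eq_self (fun t => G t i * η (x - t)) volume x] at key
  simp only [sub_sub_cancel] at key
  simp only [ContinuousLinearMap.precompL_apply, ContinuousLinearMap.lsmul_apply, smul_eq_mul,
    PiLp.smul_apply]
  simpa only [mul_comm] using key

omit [NormedSpace ℝ E] in
/-- Translations are continuous in `L¹`. -/
theorem tendsto_lintegral_enorm_translate_sub {f : RN N → E} (hf : Integrable f) :
    Tendsto (fun t : RN N => ∫⁻ x, ‖f (x - t) - f x‖ₑ) (𝓝 0) (𝓝 0) := by
  have hf1 : MemLp f 1 volume := memLp_one_iff_integrable.2 hf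
  have : Fact ((1 : ℝ≥0∞) ≠ ⊤) := ⟨ENNReal.one_ne_top⟩
  have hc : Tendsto (fun t : RN N => DomAddAct.mk (-t) +ᵥ hf1.toLp f) (𝓝 0)
      (𝓝 (DomAddAct.mk (-0 : RN N) +ᵥ hf1.toLp f)) := by
    have : Continuous fun t : RN N => DomAddAct.mk (-t) +ᵥ hf1.toLp f :=
      (DomAddAct.continuous_mk.comp continuous_neg).vadd continuous_const
    exact this.tendsto 0
  rw [neg_zero, DomAddAct.mk_zero, zero_vadd] at hc
  have := (tendsto_iff_edist_tendsto_0.1 hc)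
  refine this.congr fun t => ?_
  rw [DomAddAct.mk_vadd_toLp, Lp.edist_toLp_toLp, eLpNorm_one_eq_lintegral_enorm]
  refine lintegral_congr fun x => ?_
  simp [sub_eq_neg_add]

/-- Since η has integral 1, the error is an average of the translation errors f(· - y) - f, and
Tonelli moves the L¹ norm inside the average. -/
theorem IsMollifier.lintegral_average_sub_le [CompleteSpace E] (hη : IsMollifier v κ C δ η)
    {f : RN N → E} (hf : Integrable f) {ε : ℝ≥0∞}
    (hε : ∀ y, η y ≠ 0 → ∫⁻ x, ‖f (x - y) - f x‖ₑ ≤ ε) :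
    ∫⁻ x, ‖average η f x - f x‖ₑ ≤ ε := by
  have iη : Integrable η := hη.smooth.continuous.integrable_of_hasCompactSupport hη.compact_support
  have hpt : ∀ x, ‖average η f x - f x‖ₑ ≤ ∫⁻ y, ‖η y‖ₑ * ‖f (x - y) - f x‖ₑ := by
    intro x
    have : average η f x - f x = ∫ y, η y • (f (x - y) - f x) := by
      simp only [smul_sub]
      rw [integral_sub (hη.integrable_smul hf x) (iη.smul_const _), integral_smul_const,
        hη.integral_eq, one_smul, average]
    rw [this]
    refine (enorm_integral_le_lintegral_enorm _).trans_eq (lintegral_congr fun y => ?_)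
    rw [enorm_smul]
  have hm : AEMeasurable (Function.uncurry fun x y : RN N => ‖η y‖ₑ * ‖f (x - y) - f x‖ₑ)
      (volume.prod volume) := by
    have h1 : AEMeasurable (fun p : RN N × RN N => ‖η p.2‖ₑ) (volume.prod volume) :=
      (hη.smooth.continuous.comp continuous_snd).enorm.measurable.aemeasurable
    have h2 : AEStronglyMeasurable (fun p : RN N × RN N => f (p.1 - p.2)) (volume.prod volume) :=
      hf.1.comp_quasiMeasurePreserving
        (quasiMeasurePreserving_sub_of_right_invariant volume volume)
    exact h1.mul (h2.sub hf.1.comp_fst).enorm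
  calc ∫⁻ x, ‖average η f x - f x‖ₑ ≤ ∫⁻ x, ∫⁻ y, ‖η y‖ₑ * ‖f (x - y) - f x‖ₑ :=
        lintegral_mono hpt
    _ = ∫⁻ y, ‖η y‖ₑ * ∫⁻ x, ‖f (x - y) - f x‖ₑ := by
        rw [lintegral_lintegral_swap hm]
        exact lintegral_congr fun y => lintegral_const_mul' _ _ enorm_ne_top
    _ ≤ ∫⁻ y, ‖η y‖ₑ * ε := by
        refine lintegral_mono fun y => ?_
        by_cases h : η y = 0
        · simp [h]
        · exact mul_le_mul_right (hε y h) _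
    _ = ε := by
        rw [lintegral_mul_const _ hη.smooth.continuous.enorm.measurable,
          ← ofReal_integral_norm_eq_lintegral_enorm iη]
        simp only [Real.norm_of_nonneg (hη.nonneg _)]
        rw [hη.integral_eq, ENNReal.ofReal_one, one_mul]

/-- Convolutions with mollifiers converge in `L¹`. -/
theorem tendsto_lintegral_average_sub [CompleteSpace E] {η : ℝ → RN N → ℝ}
    (hη : ∀ δ, 0 < δ → IsMollifier v κ C δ (η δ)) (hv : ‖v‖ + κ ≤ 1) {f : RN N → E}
    (hf : Integrable f) :
    Tendsto (fun δ => ∫⁻ x, ‖average (η δ) f x - f x‖ₑ) (𝓝[>] 0) (𝓝 0) := by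
  rw [ENNReal.tendsto_nhds_zero]
  intro ε hε
  obtain ⟨r, hr, hball⟩ := Metric.eventually_nhds_iff.1
    ((ENNReal.tendsto_nhds_zero.1 (tendsto_lintegral_enorm_translate_sub hf)) ε hε)
  filter_upwards [Ioo_mem_nhdsGT hr] with δ hδ
  refine (hη δ hδ.1).lintegral_average_sub_le hf fun y hy => hball ?_
  have h1 := (hη δ hδ.1).support y hy
  have h2 : ‖y‖ ≤ ‖y - δ • v‖ + ‖δ • v‖ := norm_le_norm_sub_add _ _
  rw [norm_smul, Real.norm_of_nonneg hδ.1.le] at h2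
  rw [dist_zero_right]
  nlinarith [hδ.1, hδ.2]

end average

end MusielakOrlicz

/-! ### Lipschitz domains: inward directions and a partition of unity -/

namespace MusielakOrlicz

variable {N : ℕ} {Ω : Set (RN N)}

/-- Near a point of `closure Ω`, small balls about a translate of `x ∈ closure Ω` in a suitable
direction `v` lie in `Ω`. -/
theorem IsLipschitzDomain.exists_inward_direction (hΩ : IsLipschitzDomain Ω) {x₀ : RN N}
    (hx₀ : x₀ ∈ closure Ω) :
    ∃ U : Set (RN N), IsOpen U ∧ x₀ ∈ U ∧ ∃ (v : RN N) (κ : ℝ), 0 < κ ∧ ‖v‖ + κ ≤ 1 ∧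
      ∀ K : Set (RN N), IsCompact K → K ⊆ U → K ⊆ closure Ω → ∃ δ₁ > (0 : ℝ), ∀ δ, 0 < δ → δ < δ₁ →
        ∀ x ∈ K, ∀ y, ‖y - x - δ • v‖ ≤ κ * δ → y ∈ Ω := by
  by_cases hx : x₀ ∈ Ω
  · refine ⟨Ω, hΩ.isOpen, hx, 0, 1, one_pos, by simp, fun K hK hKU _ => ?_⟩
    obtain ⟨δ₁, hδ₁, hsub⟩ := hK.exists_thickening_subset_open hΩ.isOpen hKU
    refine ⟨δ₁, hδ₁, fun δ hδ hlt x hxK y hy => hsub ?_⟩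
    rw [smul_zero, sub_zero, one_mul] at hy
    exact Metric.mem_thickening_iff.2 ⟨x, hxK, (dist_eq_norm y x).trans_lt (hy.trans_lt hlt)⟩
  have hfr : x₀ ∈ frontier Ω := by
    rw [hΩ.isOpen.frontier_eq]
    exact ⟨hx₀, hx⟩
  obtain ⟨r, hr, e, he, L, γ, hγ, heq⟩ := hΩ.locally_supergraph x₀ hfr
  have hL : (0 : ℝ) ≤ L := L.2
  -- The shift by (δ/2)e gains height δ/2. An error w with ‖w‖ ≤ κδ loses at most κδ in height and
  -- moves the projection by at most 2κδ, hence raises γ by at most 2Lκδ. This κ makes the total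
  -- loss δ/4.
  set κ : ℝ := (4 * (1 + 2 * L))⁻¹ with hκ
  have hκ0 : 0 < κ := by positivity
  have hκL : κ + 2 * L * κ = 1 / 4 := by
    rw [hκ]
    field_simp
  refine ⟨Metric.ball x₀ r, Metric.isOpen_ball, Metric.mem_ball_self hr, (2 : ℝ)⁻¹ • e, κ, hκ0, ?_,
    fun K hK hKU hKΩ => ?_⟩
  · rw [norm_smul, he]
    norm_num
    nlinarith
  obtain ⟨δ₁, hδ₁, hsub⟩ := hK.exists_thickening_subset_open Metric.isOpen_ball hKU
  refine ⟨δ₁, hδ₁, fun δ hδ hlt x hxK y hy => ?_⟩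
  set w := y - x - δ • (2 : ℝ)⁻¹ • e with hw
  have hyx : y = x + (δ / 2) • e + w := by
    rw [hw, smul_smul, ← div_eq_mul_inv]
    abel
  have hyball : y ∈ Metric.ball x₀ r := by
    refine hsub (Metric.mem_thickening_iff.2 ⟨x, hxK, ?_⟩)
    have h1 : y - x = (δ / 2) • e + w := by
      rw [hyx]
      abel
    rw [dist_eq_norm, h1]
    refine (norm_add_le _ _).trans_lt ?_
    rw [norm_smul, he, Real.norm_of_nonneg (by positivity)]
    nlinarith
  -- Points of the closure satisfy only the non-strict inequality; the surplus δ/4 makes it strict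
  -- after the shift.
  have hproj : Continuous fun x : RN N => inner ℝ e x := continuous_const.inner continuous_id
  have hx1 : γ (x - (inner ℝ e x) • e) ≤ inner ℝ e x := by
    have hcl : IsClosed {x : RN N | γ (x - (inner ℝ e x) • e) ≤ inner ℝ e x} :=
      isClosed_le (hγ.continuous.comp (continuous_id.sub (hproj.smul continuous_const))) hproj
    have h1 : x ∈ closure (Metric.ball x₀ r ∩ Ω) :=
      Metric.isOpen_ball.inter_closure ⟨hKU hxK, hKΩ hxK⟩
    refine closure_minimal (fun z hz => ?_) hcl h1
    have : z ∈ Ω ∩ Metric.ball x₀ r := ⟨hz.2, hz.1⟩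
    rw [heq] at this
    exact le_of_lt (a := γ (z - (inner ℝ e z) • e)) (b := inner ℝ e z) this.1
  have hee : inner ℝ e e = (1 : ℝ) := by rw [real_inner_self_eq_norm_sq, he, one_pow]
  have hey : inner ℝ e y = inner ℝ e x + δ / 2 + inner ℝ e w := by
    rw [hyx, inner_add_right, inner_add_right, real_inner_smul_right, hee, mul_one]
  have hew : |inner ℝ e w| ≤ κ * δ := by
    refine (abs_real_inner_le_norm e w).trans ?_
    rwa [he, one_mul]
  have hdiff : dist (y - (inner ℝ e y) • e) (x - (inner ℝ e x) • e) ≤ 2 * (κ * δ) := by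
    have : (y - (inner ℝ e y) • e) - (x - (inner ℝ e x) • e) = w - (inner ℝ e w) • e := by
      rw [hey, add_smul, add_smul]
      nth_rewrite 1 [hyx]
      abel
    rw [dist_eq_norm, this]
    refine (norm_sub_le _ _).trans ?_
    rw [norm_smul, he, mul_one, Real.norm_eq_abs]
    linarith
  have hlip := (le_abs_self _).trans ((Real.dist_eq _ _).symm.trans_le (hγ.dist_le_mul
    (y - (inner ℝ e y) • e) (x - (inner ℝ e x) • e)))
  have hmem : y ∈ {x | γ (x - (inner ℝ e x) • e) < inner ℝ e x} ∩ Metric.ball x₀ r := by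
    refine ⟨?_, hyball⟩
    change γ (y - (inner ℝ e y) • e) < inner ℝ e y
    have h1 := mul_le_mul_of_nonneg_left hdiff hL
    have h2 := (abs_le.1 hew).1
    nlinarith
  rw [← heq] at hmem
  exact hmem.1

/-- A finite smooth partition of unity on `Ω`, with an inward direction for every member. -/
theorem IsLipschitzDomain.exists_partition (hΩ : IsLipschitzDomain Ω)
    (hb : Bornology.IsBounded Ω) :
    ∃ (ι : Type) (_ : Fintype ι) (θ : ι → RN N → ℝ) (v : ι → RN N) (κ : ι → ℝ),
      (∀ i, ContDiff ℝ ∞ (θ i)) ∧ (∀ i, 0 < κ i) ∧ (∀ i, ‖v i‖ + κ i ≤ 1) ∧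
      (∀ i, ∃ δ₁ > (0 : ℝ), ∀ δ, 0 < δ → δ < δ₁ → ∀ x ∈ tsupport (θ i) ∩ closure Ω,
        ∀ y, ‖y - x - δ • v i‖ ≤ κ i * δ → y ∈ Ω) ∧
      ∀ x ∈ Ω, ∑ i, θ i x = 1 := by
  have hK : IsCompact (closure Ω) := hb.isCompact_closure
  choose! U hUo hUx v κ hκ hvκ hU using fun x (hx : x ∈ closure Ω) => hΩ.exists_inward_direction hx
  obtain ⟨t, ht, hcov⟩ := hK.elim_nhds_subcover U fun x hx => (hUo x hx).mem_nhds (hUx x hx)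
  obtain ⟨f, hf⟩ := SmoothPartitionOfUnity.exists_isSubordinate (modelWithCornersSelf ℝ (RN N))
    hK.isClosed (fun i : t => U i) (fun i => hUo i (ht i i.2))
    (fun x hx => by
      obtain ⟨i, hi, hxi⟩ := Set.mem_iUnion₂.1 (hcov hx)
      exact Set.mem_iUnion.2 ⟨⟨i, hi⟩, hxi⟩)
  let σ := t.equivFin
  refine ⟨Fin t.card, inferInstance, fun i => f (σ.symm i), fun i => v (σ.symm i),
    fun i => κ (σ.symm i), fun i => (f _).contMDiff.contDiff, fun i => hκ _ (ht _ (σ.symm i).2),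
    fun i => hvκ _ (ht _ (σ.symm i).2), fun i => ?_, fun x hx => ?_⟩
  · exact hU _ (ht _ (σ.symm i).2) _ (hK.inter_left (isClosed_tsupport _))
      (Set.inter_subset_left.trans (hf (σ.symm i))) Set.inter_subset_right
  · have := f.sum_eq_one (subset_closure hx)
    rw [finsum_eq_sum_of_fintype] at this
    rw [← this]
    exact σ.symm.sum_comp fun i => f i x

end MusielakOrlicz

/-! ### The pointwise estimate from condition (M) and modular convergence of mollifications -/

namespace MusielakOrlicz

variable {N : ℕ} {Ω S : Set (RN N)} {M M' : RN N → RN N → ℝ} {v : RN N} {κ C δ : ℝ}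

theorem IsMollifier.norm_le_of_ne_zero {η : RN N → ℝ} (hη : IsMollifier v κ C δ η)
    (hv : ‖v‖ + κ ≤ 1) (hδ : 0 < δ) {y : RN N} (hy : η y ≠ 0) : ‖y‖ ≤ δ := by
  have h1 := hη.support y hy
  have h2 : ‖y‖ ≤ ‖y - δ • v‖ + ‖δ • v‖ := norm_le_norm_sub_add _ _
  rw [norm_smul, Real.norm_of_nonneg hδ.le] at h2
  nlinarith

theorem IsMollifier.average_nonneg {η F : RN N → ℝ} (hη : IsMollifier v κ C δ η)
    (hF : ∀ x, 0 ≤ F x) (x : RN N) : 0 ≤ average η F x :=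
  integral_nonneg fun y => mul_nonneg (hη.nonneg y) (hF _)

/-- With s = r = δ this explains the enlarged cube: a kernel supported in the δ-ball only sees
points of the concentric cube of edge 4δ. -/
theorem mem_cube_of_norm_sub_le {R : RN N ≃ₗᵢ[ℝ] RN N} {p x y : RN N} {s r : ℝ}
    (hx : x ∈ cube R p s) (h : ‖y - x‖ ≤ r) : y ∈ cube R p (s + r) := by
  intro i
  have h1 : R (y - p) = R (x - p) + R (y - x) := by
    rw [← map_add]
    congr 1
    abel
  have h2 : |R (y - x) i| ≤ r := (abs_apply_le _ i).trans (by rwa [R.norm_map])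
  rw [h1, PiLp.add_apply]
  exact (abs_add_le _ _).trans (add_le_add (hx i) h2)

/-- Jensen's inequality for the second conjugate of a local infimum of `M`. -/
theorem IsMollifier.biconjugate_average_le {η : RN N → ℝ} (hη : IsMollifier v κ C δ η)
    (hv : ‖v‖ + κ ≤ 1) (hδ : 0 < δ) (hM' : IsConvexIntegrand M') (hS : ∀ᵐ x, x ∈ Ω → x ∈ S)
    (hMS : ∀ x ∈ S, M' x = M x) {T : Set (RN N)} {x : RN N} (hxS : x ∈ S) (hxT : x ∈ T)
    (hT : ∀ y ∈ Ω, ‖y - x‖ ≤ δ → y ∈ T) {G : RN N → RN N} (hG : Integrable G)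
    (hG0 : ∀ x ∉ Ω, G x = 0) (hF : Integrable fun x => M' x (G x)) :
    conjugate (conjugate (infOver M T)) (average η G x) ≤
      (average η (fun x => M' x (G x)) x : ℝ) := by
  -- The second conjugate is a supremum of affine functions, and averaging against a probability
  -- density commutes with an affine function; so Jensen is proved for each slope ζ separately.
  refine iSup_le fun ζ => ?_
  have hlow : ∀ y ∈ T, ∀ z, ((inner ℝ z ζ - M y z : ℝ) : EReal) ≤ conjugate (infOver M T) ζ := by
    intro y hy z
    refine le_trans ?_ (le_iSup (fun z => ((inner ℝ z ζ : ℝ) : EReal) - infOver M T z) z)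
    rw [EReal.coe_sub]
    exact EReal.sub_le_sub le_rfl (iInf₂_le y hy)
  -- The value -∞ is excluded by testing at x ∈ T; the value +∞ makes the affine minorant -∞, which
  -- is trivial.
  induction hc : conjugate (infOver M T) ζ with
  | bot =>
    have := hlow x hxT 0
    rw [hc] at this
    exact absurd this (by simp)
  | top => simp
  | coe m =>
    simp only [hc, EReal.coe_le_coe_iff] at hlow
    rw [← EReal.coe_sub, EReal.coe_le_coe_iff]
    have iη : Integrable η :=
      hη.smooth.continuous.integrable_of_hasCompactSupport hη.compact_support
    have i1 := hη.integrable_smul hG x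
    have e1 : inner ℝ ζ (average η G x) - m = ∫ y, (inner ℝ ζ (η y • G (x - y)) - η y * m) := by
      rw [integral_sub (i1.const_inner ζ) (iη.mul_const m), integral_inner i1,
        integral_mul_const, hη.integral_eq, one_mul]
      rfl
    rw [e1]
    refine integral_mono_ae ((i1.const_inner ζ).sub (iη.mul_const m)) (hη.integrable_smul hF x) ?_
    filter_upwards [ae_comp_sub_left hS x] with y hy
    by_cases h0 : η y = 0
    · simp [h0]
    have hpos : 0 < η y := lt_of_le_of_ne (hη.nonneg y) (Ne.symm h0)
    rw [real_inner_smul_right, smul_eq_mul, ← mul_sub]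
    refine mul_le_mul_of_nonneg_left ?_ hpos.le
    by_cases hΩ : x - y ∈ Ω
    · have hT' : x - y ∈ T := by
        refine hT _ hΩ ?_
        rw [sub_sub_cancel_left, norm_neg]
        exact hη.norm_le_of_ne_zero hv hδ h0
      have := hlow _ hT' (G (x - y))
      rw [hMS _ (hy hΩ), real_inner_comm]
      linarith
    -- Outside Ω the field vanishes and no minorant of M is available; there one needs only m ≥ 0,
    -- which follows from M(x, 0) = 0 at the base point x ∈ S.
    · have := hlow x hxT 0
      rw [← hMS x hxS, hM'.zero, inner_zero_left] at this
      rw [hG0 _ hΩ, hM'.zero, inner_zero_right]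
      linarith

/-- For small δ the exponent is a / |log(bδ)|, while log(D/δ) differs from |log(bδ)| by a constant.
Their ratio tends to 1, so it is eventually at most 2 and the power is at most exp(2a). -/
theorem eventually_rpow_le {a b : ℝ} (ha : 0 < a) (hb : 0 < b) (D : ℝ) :
    ∀ᶠ δ in 𝓝[>] (0 : ℝ), ∀ r, 0 ≤ r → r ≤ D / δ →
      r ^ (-a / Real.log (b * δ)) ≤ Real.exp (2 * a) := by
  have hlim : Tendsto (fun δ : ℝ => Real.log (b * δ)) (𝓝[>] 0) atBot := by
    refine Real.tendsto_log_nhdsGT_zero.comp ?_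
    refine tendsto_nhdsWithin_iff.2 ⟨?_, ?_⟩
    · have : Tendsto (fun δ : ℝ => b * δ) (𝓝 0) (𝓝 (b * 0)) := (continuous_const_mul b).tendsto 0
      rw [mul_zero] at this
      exact this.mono_left nhdsWithin_le_nhds
    · filter_upwards [self_mem_nhdsWithin] with δ hδ using mul_pos hb hδ
  -- D may be zero or negative; a positive substitute makes its logarithm usable.
  set D' := |D| + 1 with hD'
  have hD'0 : 0 < D' := by positivity
  filter_upwards [self_mem_nhdsWithin, hlim.eventually_le_atBot (-(1 + |Real.log D' + Real.log b|))]
    with δ hδ hlog r hr0 hr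
  have hδ : 0 < δ := hδ
  set s := -Real.log (b * δ) with hs
  have hs1 : |Real.log D' + Real.log b| + 1 ≤ s := by linarith
  have hs0 : 0 < s := by linarith [abs_nonneg (Real.log D' + Real.log b)]
  have hexp : -a / Real.log (b * δ) = a / s := by rw [hs, div_neg, neg_div]
  have hle : r ≤ D' / δ :=
    hr.trans (div_le_div_of_nonneg_right ((le_abs_self D).trans (by linarith)) hδ.le)
  rw [hexp]
  refine (Real.rpow_le_rpow hr0 hle (by positivity)).trans ?_
  rw [Real.rpow_def_of_pos (by positivity), Real.exp_le_exp, Real.log_div hD'0.ne' hδ.ne']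
  have hlogδ : -Real.log δ = s + Real.log b := by
    rw [hs, Real.log_mul hb.ne' hδ.ne']
    ring
  have h1 : Real.log D' - Real.log δ ≤ 2 * s := by
    linarith [le_abs_self (Real.log D' + Real.log b)]
  calc (Real.log D' - Real.log δ) * (a / s) ≤ 2 * s * (a / s) :=
        mul_le_mul_of_nonneg_right h1 (by positivity)
    _ = 2 * a := by field_simp

/-- The pointwise estimate for the gradient of a mollified bounded function. -/
theorem ConditionM.eventually_gradient_average_le (hcond : ConditionM Ω M)
    (hM' : IsConvexIntegrand M') (hSΩ : S ⊆ Ω) (hS : ∀ᵐ x, x ∈ Ω → x ∈ S)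
    (hMS : ∀ x ∈ S, M' x = M x) {η : ℝ → RN N → ℝ}
    (hη : ∀ δ, 0 < δ → IsMollifier v κ C δ (η δ)) (hv : ‖v‖ + κ ≤ 1) {u : RN N → ℝ}
    {G : RN N → RN N} (hu : Integrable u) (hG : Integrable G) (hw : HasWeakGradient u G) {K : ℝ}
    (hK0 : 0 ≤ K) (hK : ∀ᵐ x, |u x| ≤ K) (hG0 : ∀ x ∉ Ω, G x = 0) (t : ℝ)
    (hF : Integrable fun x => M' x (t • G x)) :
    ∃ B : ℝ, 0 ≤ B ∧ ∀ᶠ δ in 𝓝[>] (0 : ℝ), ∀ x ∈ S,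
      M' x (t • gradient (average (η δ) u) x) ≤ B * average (η δ) (fun x => M' x (t • G x)) x := by
  obtain ⟨-, a, b, c, δ₀, ha, hb, hc, hδ₀, hcov⟩ := hcond
  refine ⟨c * (1 + Real.exp (2 * a)), by positivity, ?_⟩
  filter_upwards [Ioo_mem_nhdsGT hδ₀, eventually_rpow_le ha hb (|t| * (K * C))] with δ hδ hpow x hx
  have hmol := hη δ hδ.1
  obtain ⟨n, p, R, -, hsub, hineq⟩ := hcov δ hδ.1 hδ.2
  obtain ⟨j, hj⟩ := Set.mem_iUnion.1 (hsub (hSΩ hx))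
  have havg : t • gradient (average (η δ) u) x = average (η δ) (fun x => t • G x) x := by
    rw [hmol.gradient_average hu hG hw x, average, average, ← integral_smul]
    simp only [smul_comm t]
  have hnn : 0 ≤ average (η δ) (fun x => M' x (t • G x)) x :=
    hmol.average_nonneg (fun x => hM'.nonneg _ _) x
  -- Condition (M) says nothing at ξ = 0, where the estimate is trivial.
  by_cases h0 : t • gradient (average (η δ) u) x = 0
  · rw [h0, hM'.zero]
    positivity
  have hnorm : ‖t • gradient (average (η δ) u) x‖ ≤ |t| * (K * C) / δ := by
    rw [norm_smul, Real.norm_eq_abs, mul_div_assoc, mul_div_assoc]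
    exact mul_le_mul_of_nonneg_left (hmol.norm_gradient_average_le hu hK0 hK x) (abs_nonneg t)
  have h1 := hineq j x ⟨hj, hSΩ hx⟩ _ h0
  have h2 : conjugate (conjugate (infOver M (cube (R j) (p j) (2 * δ) ∩ Ω)))
      (t • gradient (average (η δ) u) x) ≤ (average (η δ) (fun x => M' x (t • G x)) x : ℝ) := by
    rw [havg]
    refine hmol.biconjugate_average_le (G := fun x => t • G x)
      (T := cube (R j) (p j) (2 * δ) ∩ Ω) hv hδ.1 hM' hS hMS hx ⟨?_, hSΩ hx⟩ (fun y hy hyx => ⟨?_, hy⟩)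
      (hG.smul t) (fun x hx => by rw [hG0 x hx, smul_zero]) hF
    · have := mem_cube_of_norm_sub_le hj (y := x) (r := δ) (by simpa using hδ.1.le)
      rwa [← two_mul] at this
    · have := mem_cube_of_norm_sub_le hj hyx
      rwa [← two_mul] at this
  have hcpos : 0 ≤ c * (1 + ‖t • gradient (average (η δ) u) x‖ ^ (-a / Real.log (b * δ))) :=
    mul_nonneg hc.le (add_nonneg zero_le_one (Real.rpow_nonneg (norm_nonneg _) _))
  have h3 := h1.trans (mul_le_mul_of_nonneg_left h2 (EReal.coe_nonneg.2 hcpos))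
  rw [← EReal.coe_mul, EReal.coe_le_coe_iff, ← hMS x hx] at h3
  refine h3.trans (mul_le_mul_of_nonneg_right ?_ hnn)
  exact mul_le_mul_of_nonneg_left (add_le_add_right (hpow _ (norm_nonneg _) hnorm) 1) hc.le

theorem IsMollifier.continuous_average {E : Type*} [NormedAddCommGroup E] [NormedSpace ℝ E]
    {η : RN N → ℝ} (hη : IsMollifier v κ C δ η) {f : RN N → E} (hf : Integrable f) :
    Continuous (average η f) := by
  rw [average_eq_convolution]
  exact hη.compact_support.continuous_convolution_left _ hη.smooth.continuous hf.locallyIntegrable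

/-- The gradients of the mollified functions converge modularly. -/
theorem ConditionM.tendsto_modular_average (hcond : ConditionM Ω M)
    (hM' : IsConvexIntegrand M') (hΩm : MeasurableSet Ω)
    (hSΩ : S ⊆ Ω) (hS : ∀ᵐ x, x ∈ Ω → x ∈ S)
    (hMS : ∀ x ∈ S, M' x = M x) {η : ℝ → RN N → ℝ}
    (hη : ∀ δ, 0 < δ → IsMollifier v κ C δ (η δ)) (hv : ‖v‖ + κ ≤ 1) {u : RN N → ℝ}
    {G : RN N → RN N} (hu : Integrable u) (hG : Integrable G) (hw : HasWeakGradient u G) {K : ℝ}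
    (hK0 : 0 ≤ K) (hK : ∀ᵐ x, |u x| ≤ K) (hG0 : ∀ x ∉ Ω, G x = 0) (t : ℝ)
    (hF : Integrable fun x => M' x (t • G x)) :
    Tendsto (fun δ => modular Ω M' fun x => (t / 2) • (gradient (average (η δ) u) x - G x))
      (𝓝[>] 0) (𝓝 0) := by
  obtain ⟨B, hB, hev⟩ := hcond.eventually_gradient_average_le hM' hSΩ hS hMS hη hv hu hG hw hK0
    hK hG0 t hF
  have hev' : ∀ᶠ δ in 𝓝[>] (0 : ℝ), 0 < δ ∧ ∀ x ∈ S, M' x (t • gradient (average (η δ) u) x) ≤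
      B * average (η δ) (fun x => M' x (t • G x)) x :=
    Eventually.and self_mem_nhdsWithin hev
  -- L¹ convergence of the gradients yields a.e. convergence only along subsequences, so the limit
  -- is checked on a further subsequence of every sequence δ_n → 0. The shift n₀ puts all indices in
  -- the range where the estimate holds.
  refine tendsto_of_subseq_tendsto fun ns hns => ?_
  obtain ⟨n₀, hn₀⟩ := eventually_atTop.1 (hns.eventually hev')
  have hns' : Tendsto (fun n => ns (n + n₀)) atTop (𝓝[>] 0) := hns.comp (tendsto_add_atTop_nat n₀)
  have hmol : ∀ n, IsMollifier v κ C (ns (n + n₀)) (η (ns (n + n₀))) := fun n =>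
    hη _ (hn₀ _ (Nat.le_add_left _ _)).1
  have hmeas : TendstoInMeasure volume (fun n => average (η (ns (n + n₀))) G) atTop G := by
    refine tendstoInMeasure_of_tendsto_eLpNorm one_ne_zero
      (fun n => ((hmol n).continuous_average hG).aestronglyMeasurable) hG.1 ?_
    simp only [eLpNorm_one_eq_lintegral_enorm]
    exact (tendsto_lintegral_average_sub hη hv hG).comp hns'
  obtain ⟨ms, hms, hae⟩ := hmeas.exists_seq_tendsto_ae
  refine ⟨fun n => ms n + n₀, ?_⟩
  set F : RN N → ℝ := fun x => M' x (t • G x) with hFdef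
  set A : ℕ → RN N → ℝ≥0∞ := fun n x => ENNReal.ofReal
    (M' x ((t / 2) • (gradient (average (η (ns (ms n + n₀))) u) x - G x))) with hA
  have hgrad : ∀ n x, gradient (average (η (ns (ms n + n₀))) u) x =
      average (η (ns (ms n + n₀))) G x := fun n x => (hmol _).gradient_average hu hG hw x
  have hS' : ∀ᵐ x ∂volume.restrict Ω, x ∈ S := (ae_restrict_iff' hΩm).2 hS
  have hAm : ∀ n, AEMeasurable (A n) (volume.restrict Ω) := fun n => by
    refine (hM'.aemeasurable_comp ?_).ennreal_ofReal
    simp only [hgrad]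
    exact ((((hmol (ms n)).continuous_average hG).aestronglyMeasurable.sub hG.1).const_smul
      (t / 2)).aemeasurable.restrict
  -- The majorant B (η * F) + F varies with n. It is split into an L¹-small error plus the fixed (B
  -- + 1)F; truncating A n at the latter leaves a sequence to which ordinary dominated convergence
  -- applies.
  have hbound : ∀ n, ∀ᵐ x ∂volume.restrict Ω, A n x ≤ ENNReal.ofReal B *
      ‖average (η (ns (ms n + n₀))) F x - F x‖ₑ +
        min (A n x) (ENNReal.ofReal ((B + 1) * F x)) := fun n => by
    filter_upwards [hS'] with x hx
    have h1 := (hn₀ (ms n + n₀) (Nat.le_add_left _ _)).2 x hx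
    have h2 := hM'.half_add_le x (t • gradient (average (η (ns (ms n + n₀))) u) x) (-(t • G x))
    rw [hM'.even, ← sub_eq_add_neg, ← smul_sub, smul_smul, inv_mul_eq_div] at h2
    have h3 : A n x ≤ ENNReal.ofReal B * ‖average (η (ns (ms n + n₀))) F x - F x‖ₑ +
        ENNReal.ofReal ((B + 1) * F x) := by
      rw [← ofReal_norm, ← ENNReal.ofReal_mul hB, ← ENNReal.ofReal_add (by positivity)
        (mul_nonneg (by positivity) (hM'.nonneg _ _))]
      refine ENNReal.ofReal_le_ofReal (h2.trans ?_)
      have h4 := mul_le_mul_of_nonneg_left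
        (le_abs_self (average (η (ns (ms n + n₀))) F x - F x)) hB
      rw [Real.norm_eq_abs]
      change M' x (t • gradient (average (η (ns (ms n + n₀))) u) x) + F x ≤ _
      linarith
    rcases le_total (A n x) (ENNReal.ofReal ((B + 1) * F x)) with h | h
    · rw [min_eq_left h]
      exact le_add_self
    · rwa [min_eq_right h]
  have hFm : ∀ n, AEMeasurable (fun x => ENNReal.ofReal B *
      ‖average (η (ns (ms n + n₀))) F x - F x‖ₑ) (volume.restrict Ω) := fun n =>
    ((((hmol (ms n)).continuous_average hF).aestronglyMeasurable.sub hF.1).enorm.const_mul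
      _).restrict
  have hle : ∀ n, ∫⁻ x in Ω, A n x ≤
      ENNReal.ofReal B * (∫⁻ x, ‖average (η (ns (ms n + n₀))) F x - F x‖ₑ) +
        ∫⁻ x in Ω, min (A n x) (ENNReal.ofReal ((B + 1) * F x)) := fun n => by
    refine (lintegral_mono_ae (hbound n)).trans ?_
    rw [lintegral_add_left' (hFm n), lintegral_const_mul' _ _ ENNReal.ofReal_ne_top]
    exact add_le_add_left (mul_le_mul_right (setLIntegral_le_lintegral _ _) _) _
  have lim1 : Tendsto (fun n => ENNReal.ofReal B *
      ∫⁻ x, ‖average (η (ns (ms n + n₀))) F x - F x‖ₑ) atTop (𝓝 0) := by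
    have := ENNReal.Tendsto.const_mul (a := ENNReal.ofReal B)
      ((tendsto_lintegral_average_sub hη hv hF).comp (hns'.comp hms.tendsto_atTop))
      (Or.inr ENNReal.ofReal_ne_top)
    rwa [mul_zero] at this
  have lim2 : Tendsto (fun n => ∫⁻ x in Ω, min (A n x) (ENNReal.ofReal ((B + 1) * F x)))
      atTop (𝓝 0) := by
    have hFB : Integrable (fun x => (B + 1) * F x) (volume.restrict Ω) :=
      (hF.const_mul (B + 1)).restrict
    have := tendsto_lintegral_of_dominated_convergence' (μ := volume.restrict Ω)
      (F := fun n x => min (A n x) (ENNReal.ofReal ((B + 1) * F x))) (f := fun _ => 0)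
      (fun x => ENNReal.ofReal ((B + 1) * F x))
      (fun n => (hAm n).min hFB.1.aemeasurable.ennreal_ofReal)
      (fun n => ae_of_all _ fun x => min_le_right _ _)
      (hFB.lintegral_lt_top.ne) ?_
    · simpa using this
    filter_upwards [ae_restrict_of_ae hae] with x hx
    have h1 : Tendsto (fun n => A n x) atTop (𝓝 0) := by
      have h2 : Tendsto (fun n => (t / 2) • (average (η (ns (ms n + n₀))) G x - G x)) atTop
          (𝓝 0) := by
        have := (hx.sub_const (G x)).const_smul (t / 2)
        rwa [sub_self, smul_zero] at this
      have h3 := ENNReal.tendsto_ofReal ((hM'.continuous x).tendsto 0 |>.comp h2)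
      rw [hM'.zero, ENNReal.ofReal_zero] at h3
      refine h3.congr fun n => ?_
      simp only [hA, hgrad, Function.comp]
    have h4 := h1.min (tendsto_const_nhds (x := ENNReal.ofReal ((B + 1) * F x)))
    rwa [min_eq_left (zero_le)] at h4
  have lim := lim1.add lim2
  rw [add_zero] at lim
  exact tendsto_of_tendsto_of_tendsto_of_le_of_le tendsto_const_nhds lim (fun _ => zero_le) hle

end MusielakOrlicz

/-! ### Test functions, localization and gluing -/

namespace MusielakOrlicz

variable {N : ℕ} {Ω S : Set (RN N)} {M M' : RN N → RN N → ℝ}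

theorem modular_congr (h : ∀ᵐ x ∂volume.restrict Ω, M' x = M x) (ξ : RN N → RN N) :
    modular Ω M ξ = modular Ω M' ξ :=
  lintegral_congr_ae (by filter_upwards [h] with x hx; rw [hx])

theorem orliczSpace_congr (h : ∀ᵐ x ∂volume.restrict Ω, M' x = M x) :
    orliczSpace Ω M = orliczSpace Ω M' := by
  unfold orliczSpace orliczClass
  simp only [modular_congr h]

namespace IsTestFunction

theorem zero : IsTestFunction Ω (fun _ => 0) := by
  refine ⟨contDiff_const, HasCompactSupport.zero, ?_⟩
  rw [show (fun _ : RN N => (0 : ℝ)) = 0 from rfl, tsupport_zero]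
  exact Set.empty_subset _

theorem add {f h : RN N → ℝ} (hf : IsTestFunction Ω f) (hh : IsTestFunction Ω h) :
    IsTestFunction Ω (fun x => f x + h x) :=
  ⟨hf.smooth.add hh.smooth, hf.compact_support.add hh.compact_support,
    (tsupport_add f h).trans (Set.union_subset hf.support_subset hh.support_subset)⟩

theorem sum {ι : Type*} (s : Finset ι) {f : ι → RN N → ℝ} (hf : ∀ i, IsTestFunction Ω (f i)) :
    IsTestFunction Ω (fun x => ∑ i ∈ s, f i x) := by
  classical
  induction s using Finset.induction_on with
  | empty => simpa using zero
  | insert i s hi ih =>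
    simp only [Finset.sum_insert hi]
    exact (hf i).add ih

end IsTestFunction

theorem gradient_sum {ι : Type*} (s : Finset ι) {f : ι → RN N → ℝ} {x : RN N}
    (hf : ∀ i ∈ s, DifferentiableAt ℝ (f i) x) :
    gradient (fun x => ∑ i ∈ s, f i x) x = ∑ i ∈ s, gradient (f i) x := by
  unfold gradient
  rw [fderiv_fun_sum hf, map_sum]

/-- The support lies in K plus the closed ball of radius κδ about δv, a compact set that the
direction hypothesis places inside Ω. -/
theorem IsMollifier.isTestFunction_average {v : RN N} {κ C δ : ℝ} {η : RN N → ℝ}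
    (hη : IsMollifier v κ C δ η) {u : RN N → ℝ} (hu : Integrable u) {K : Set (RN N)}
    (hK : IsCompact K) (huK : ∀ x ∉ K, u x = 0)
    (hKΩ : ∀ x ∈ K, ∀ y, ‖y - x - δ • v‖ ≤ κ * δ → y ∈ Ω) :
    IsTestFunction Ω (average η u) := by
  open scoped Pointwise in
  have hZ : IsCompact (K + Metric.closedBall (δ • v) (κ * δ)) :=
    hK.add (isCompact_closedBall _ _)
  have hsub : Function.support (average η u) ⊆ K + Metric.closedBall (δ • v) (κ * δ) := by
    intro x hx
    obtain ⟨y, hy, hxy⟩ := hη.support_average huK hx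
    exact ⟨y, hy, x - y, mem_closedBall_iff_norm.2 hxy, add_sub_cancel _ _⟩
  refine ⟨hη.contDiff_average hu, HasCompactSupport.of_support_subset_isCompact hZ hsub,
    (closure_minimal hsub hZ.isClosed).trans ?_⟩
  rintro _ ⟨x, hx, y, hy, rfl⟩
  exact hKΩ x hx _ (by rw [add_sub_cancel_left]; exact mem_closedBall_iff_norm.1 hy)

/-- Modular convergence to zero is stable under finite sums. -/
theorem IsConvexIntegrand.tendsto_modular_sum (hM : IsConvexIntegrand M) {ι α : Type*}
    {l : Filter α} (s : Finset ι) {ζ : ι → α → RN N → RN N}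
    (hζ : ∀ i, ∀ᶠ a in l, AEStronglyMeasurable (ζ i a) (volume.restrict Ω))
    (h : ∀ i, ∃ t > (0 : ℝ), Tendsto (fun a => modular Ω M fun x => t • ζ i a x) l (𝓝 0)) :
    ∃ t > (0 : ℝ), Tendsto (fun a => modular Ω M fun x => t • ∑ i ∈ s, ζ i a x) l (𝓝 0) := by
  classical
  induction s using Finset.induction_on with
  | empty => exact ⟨1, one_pos, by simpa [modular, hM.zero] using tendsto_const_nhds⟩
  | insert i s hi ih =>
    obtain ⟨r, hr, hr'⟩ := ih
    obtain ⟨t, ht, ht'⟩ := h i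
    have hm : 0 < min t r := lt_min ht hr
    refine ⟨2⁻¹ * min t r, by positivity, ?_⟩
    have hlim := ht'.add hr'
    rw [add_zero] at hlim
    refine tendsto_of_tendsto_of_tendsto_of_le_of_le' tendsto_const_nhds hlim
      (Eventually.of_forall fun _ => zero_le) ?_
    filter_upwards [hζ i] with a ha
    simp only [Finset.sum_insert hi, mul_smul, smul_add (min t r)]
    refine (hM.modular_half_add_le (ha.const_smul (min t r))).trans (add_le_add ?_ ?_)
    · refine hM.modular_smul_le _ ?_
      rw [abs_of_pos hm, abs_of_pos ht]
      exact min_le_left _ _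
    · refine hM.modular_smul_le _ ?_
      rw [abs_of_pos hm, abs_of_pos hr]
      exact min_le_right _ _

/-- A truncation `θ φ` of a bounded function `φ ∈ V_0^M` by a smooth function `θ` can be
approximated by test functions, if `Ω` has an inward direction along the support of `θ`. -/
theorem ConditionM.exists_approximation_smooth_mul (hcond : ConditionM Ω M)
    (hM' : IsConvexIntegrand M') (hΩ : IsOpen Ω) (hb : Bornology.IsBounded Ω) (hSΩ : S ⊆ Ω)
    (hS : ∀ᵐ x, x ∈ Ω → x ∈ S) (hMS : ∀ x ∈ S, M' x = M x) (hM0 : ∀ x ∉ S, M' x = 0)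
    (hint : ∀ z, ∫⁻ x in Ω, ENNReal.ofReal (M' x z) < ⊤)
    {φ : RN N → ℝ} {g : RN N → RN N} (hφ : IntegrableOn φ Ω) (hg : IntegrableOn g Ω)
    (hw : HasWeakGradient (Ω.indicator φ) (Ω.indicator g)) {K : ℝ} (hK0 : 0 ≤ K)
    (hK : ∀ᵐ x ∂volume.restrict Ω, |φ x| ≤ K) (hgM : g ∈ orliczSpace Ω M')
    {θ : RN N → ℝ} (hθ : ContDiff ℝ ∞ θ) {v : RN N} {κ : ℝ} (hκ : 0 < κ) (hv : ‖v‖ + κ ≤ 1)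
    (hdir : ∃ δ₁ > (0 : ℝ), ∀ δ, 0 < δ → δ < δ₁ → ∀ x ∈ tsupport θ ∩ closure Ω,
      ∀ y, ‖y - x - δ • v‖ ≤ κ * δ → y ∈ Ω) :
    ∃ ψ : ℝ → RN N → ℝ, (∀ᶠ δ in 𝓝[>] (0 : ℝ), IsTestFunction Ω (ψ δ)) ∧
      ∃ t > (0 : ℝ), Tendsto (fun δ => modular Ω M' fun x =>
        t • (gradient (ψ δ) x - (θ x • g x + φ x • gradient θ x))) (𝓝[>] 0) (𝓝 0) := by
  obtain ⟨C, η, hη⟩ := exists_isMollifier v hκ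
  have hcl : IsCompact (closure Ω) := hb.isCompact_closure
  obtain ⟨B, hB⟩ := hcl.exists_bound_of_continuousOn hθ.continuous.continuousOn
  obtain ⟨D, hD⟩ := hcl.exists_bound_of_continuousOn (continuous_gradient hθ).continuousOn
  have hmem : ∀ᵐ x ∂volume.restrict Ω, x ∈ closure Ω := by
    filter_upwards [ae_restrict_mem hΩ.measurableSet] with x hx using subset_closure hx
  set u : RN N → ℝ := fun x => θ x * Ω.indicator φ x with hu
  set G : RN N → RN N := fun x => θ x • Ω.indicator g x + Ω.indicator φ x • gradient θ x with hG
  have iθφ : IntegrableOn (fun x => θ x * φ x) Ω :=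
    Integrable.bdd_mul (c := B) hφ hθ.continuous.aestronglyMeasurable
      (hmem.mono fun x hx => hB x hx)
  have iθg : IntegrableOn (fun x => θ x • g x) Ω :=
    Integrable.bdd_smul hg B hθ.continuous.aestronglyMeasurable (hmem.mono fun x hx => hB x hx)
  have iφθ : IntegrableOn (fun x => φ x • gradient θ x) Ω :=
    Integrable.smul_bdd hφ D (continuous_gradient hθ).aestronglyMeasurable
      (hmem.mono fun x hx => hD x hx)
  have hueq : u = Ω.indicator fun x => θ x * φ x := by
    ext1 x
    by_cases hx : x ∈ Ω <;> simp [hu, hx]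
  have hGeq : G = Ω.indicator fun x => θ x • g x + φ x • gradient θ x := by
    ext1 x
    by_cases hx : x ∈ Ω <;> simp [hG, hx]
  have iu : Integrable u := by
    rw [hueq]
    exact iθφ.integrable_indicator hΩ.measurableSet
  have iG : Integrable G := by
    rw [hGeq]
    exact (iθg.add iφθ).integrable_indicator hΩ.measurableSet
  have hwu : HasWeakGradient u G := hw.smooth_mul (hφ.integrable_indicator hΩ.measurableSet)
    (hg.integrable_indicator hΩ.measurableSet) hθ
  have hG0 : ∀ x ∉ Ω, G x = 0 := fun x hx => by rw [hGeq, Set.indicator_of_notMem hx]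
  have hub : ∀ᵐ x, |u x| ≤ |B| * K := by
    filter_upwards [(ae_restrict_iff' hΩ.measurableSet).1 hK] with x hx
    by_cases hxΩ : x ∈ Ω
    · simp only [hu, Set.indicator_of_mem hxΩ, abs_mul]
      exact mul_le_mul ((hB x (subset_closure hxΩ)).trans (le_abs_self B)) (hx hxΩ) (abs_nonneg _)
        (abs_nonneg _)
    · simp only [hu, Set.indicator_of_notMem hxΩ, mul_zero, abs_zero]
      positivity
  -- In the product rule, θg inherits finite modular from g after dividing the scale by a bound for
  -- θ, while φ∇θ is bounded.
  have hmod : (fun x => θ x • g x + φ x • gradient θ x) ∈ orliczSpace Ω M' := by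
    refine Submodule.add_mem _ ?_ ?_
    · obtain ⟨hgm, s, hs, hs'⟩ := hM'.mem_orliczSpace_iff.1 hgM
      refine hM'.mem_orliczSpace_iff.2 ⟨iθg.1, s / (|B| + 1), by positivity, ?_⟩
      refine (lintegral_mono_ae ?_).trans_lt hs'
      filter_upwards [hmem] with x hx
      refine ENNReal.ofReal_le_ofReal ?_
      rw [smul_smul]
      refine hM'.smul_le_smul _ _ ?_
      have h1 : |θ x| ≤ |B| + 1 := (hB x hx).trans ((le_abs_self B).trans (by linarith))
      rw [abs_mul, abs_div, abs_of_pos (by positivity : 0 < |B| + 1), div_mul_eq_mul_div]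
      exact div_le_of_le_mul₀ (by positivity) (abs_nonneg _)
        (mul_le_mul_of_nonneg_left h1 (abs_nonneg _))
    · refine hM'.mem_orliczSpace_iff.2 ⟨iφθ.1, 1, one_pos, ?_⟩
      refine hM'.modular_lt_top_of_bounded hint (K := K * D) ?_
      filter_upwards [hK, hmem] with x hx hx'
      rw [one_smul, norm_smul]
      exact mul_le_mul hx (hD x hx') (norm_nonneg _) hK0
  obtain ⟨-, t, ht, hfin⟩ := hM'.mem_orliczSpace_iff.1 hmod
  have hF : Integrable fun x => M' x (t • G x) := by
    have hm : AEStronglyMeasurable (fun x => M' x (t • G x)) volume :=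
      (hM'.aemeasurable_comp (iG.1.const_smul t).aemeasurable).aestronglyMeasurable
    refine ⟨hm, ?_⟩
    rw [hasFiniteIntegral_iff_ofReal (ae_of_all _ fun x => hM'.nonneg _ _)]
    refine lt_of_le_of_lt (le_of_eq ?_) hfin
    rw [modular, ← lintegral_indicator hΩ.measurableSet]
    refine lintegral_congr fun x => ?_
    by_cases hx : x ∈ Ω
    · rw [hGeq, Set.indicator_of_mem hx, Set.indicator_of_mem hx]
    · rw [Set.indicator_of_notMem hx, hM0 x fun h => hx (hSΩ h)]
      simp
  refine ⟨fun δ => average (η δ) u, ?_, t / 2, by positivity, ?_⟩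
  · obtain ⟨δ₁, hδ₁, hdir⟩ := hdir
    filter_upwards [Ioo_mem_nhdsGT hδ₁] with δ hδ
    refine (hη δ hδ.1).isTestFunction_average iu (hcl.inter_left (isClosed_tsupport θ))
      (fun x hx => ?_) (hdir δ hδ.1 hδ.2)
    rw [hueq]
    by_cases hxΩ : x ∈ Ω
    · have : x ∉ tsupport θ := fun h => hx ⟨h, subset_closure hxΩ⟩
      rw [Set.indicator_of_mem hxΩ, image_eq_zero_of_notMem_tsupport this, zero_mul]
    · rw [Set.indicator_of_notMem hxΩ]
  · have := hcond.tendsto_modular_average hM' hΩ.measurableSet hSΩ hS hMS hη hv iu iG hwu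
      (by positivity) hub hG0 t hF
    refine this.congr fun δ => setLIntegral_congr_fun hΩ.measurableSet fun x hx => ?_
    simp only [hGeq, Set.indicator_of_mem hx]

end MusielakOrlicz

theorem theorem2p2 {N : ℕ} (hN : 1 < N) (Ω : Set (MusielakOrlicz.RN N))
    (hΩ : MusielakOrlicz.IsLipschitzDomain Ω) (hΩb : Bornology.IsBounded Ω)
    (M : MusielakOrlicz.RN N → MusielakOrlicz.RN N → ℝ)
    (hM : MusielakOrlicz.IsNFunction Ω M) (hcond : MusielakOrlicz.ConditionM Ω M)
    (φ : MusielakOrlicz.RN N → ℝ) (hφ : MusielakOrlicz.MemV0 Ω M φ)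
    (hφb : MemLp φ ⊤ (volume.restrict Ω))
    (g : MusielakOrlicz.RN N → MusielakOrlicz.RN N)
    (hg : MusielakOrlicz.IsWeakGradient Ω φ g) :
    ∃ φs : ℝ → MusielakOrlicz.RN N → ℝ,
      (∀ δ : ℝ, 0 < δ → MusielakOrlicz.IsTestFunction Ω (φs δ)) ∧
      MusielakOrlicz.ModularTendsto Ω M (fun δ => gradient (φs δ)) (𝓝[>] 0) g := by
  open MusielakOrlicz in
  classical
  have hΩm := hΩ.isOpen.measurableSet
  obtain ⟨S, M', -, hSΩ, hSae, hMS, hM0, hM'⟩ := hM.exists_isConvexIntegrand hΩm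
  have hae : ∀ᵐ x ∂volume.restrict Ω, M' x = M x := hSae.mono hMS
  have hint : ∀ z, ∫⁻ x in Ω, ENNReal.ofReal (M' x z) < ⊤ := fun z => by
    have := hcond.1 Ω hΩm subset_rfl z
    rwa [lintegral_congr_ae (g := fun x => ENNReal.ofReal (M' x z))
      (by filter_upwards [hae] with x hx; rw [hx])] at this
  obtain ⟨hW, g₁, hg₁, hg₁M⟩ := hφ
  obtain ⟨iφ, ig, hw⟩ := hW.hasWeakGradient_indicator hΩ.isOpen hg
  have hgM : g ∈ orliczSpace Ω M' := by
    rw [orliczSpace_congr hae] at hg₁M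
    obtain ⟨-, t, ht, hfin⟩ := hM'.mem_orliczSpace_iff.1 hg₁M
    refine hM'.mem_orliczSpace_iff.2 ⟨ig.1, t, ht, ?_⟩
    rwa [modular, lintegral_congr_ae (g := fun x => ENNReal.ofReal (M' x (t • g₁ x)))]
    filter_upwards [hg.ae_eq hΩ.isOpen hg₁] with x hx
    rw [hx]
  set K : ℝ := (eLpNorm φ ⊤ (volume.restrict Ω)).toReal with hKdef
  have hK : ∀ᵐ x ∂volume.restrict Ω, |φ x| ≤ K := by
    filter_upwards [ae_le_eLpNormEssSup (f := φ) (μ := volume.restrict Ω)] with x hx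
    rw [hKdef, ← Real.norm_eq_abs, ← toReal_enorm, eLpNorm_exponent_top]
    refine ENNReal.toReal_mono ?_ hx
    rw [← eLpNorm_exponent_top]
    exact hφb.2.ne
  obtain ⟨ι, _, θ, v, κ, hθ, hκ, hv, hdir, hsum⟩ := hΩ.exists_partition hΩb
  choose ψ hψ t ht hlim using fun i => hcond.exists_approximation_smooth_mul hM' hΩ.isOpen hΩb hSΩ
    ((ae_restrict_iff' hΩm).1 hSae) hMS hM0 hint iφ ig hw ENNReal.toReal_nonneg hK hgM (hθ i)
    (hκ i) (hv i) (hdir i)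
  have hψ' : ∀ᶠ δ in 𝓝[>] (0 : ℝ), ∀ i, IsTestFunction Ω (ψ i δ) := eventually_all.2 hψ
  -- The sum of the partition functions is constant on the open set Ω, so its gradient vanishes
  -- there and the φ∇θ terms cancel.
  have hpart : ∀ x ∈ Ω, ∑ i, (θ i x • g x + φ x • gradient (θ i) x) = g x := by
    intro x hx
    have h1 : gradient (fun x => ∑ i, θ i x) x = 0 := by
      have : (fun x => ∑ i, θ i x) =ᶠ[𝓝 x] fun _ => 1 := by
        filter_upwards [hΩ.isOpen.mem_nhds hx] with y hy using hsum y hy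
      rw [this.gradient_eq, gradient_fun_const]
    rw [gradient_sum _ fun i _ => (hθ i).differentiable (by simp) x] at h1
    rw [Finset.sum_add_distrib, ← Finset.sum_smul, ← Finset.smul_sum, hsum x hx, h1, one_smul,
      smul_zero, add_zero]
  obtain ⟨s, hs, hs'⟩ := hM'.tendsto_modular_sum (Ω := Ω) (l := 𝓝[>] (0 : ℝ)) Finset.univ
    (ζ := fun i δ x => gradient (ψ i δ) x - (θ i x • g x + φ x • gradient (θ i) x))
    (fun i => by
      filter_upwards [hψ i] with δ hδ
      exact (continuous_gradient hδ.smooth).aestronglyMeasurable.sub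
        (((hθ i).continuous.aestronglyMeasurable.smul ig.1).add
          (iφ.1.smul (continuous_gradient (hθ i)).aestronglyMeasurable)))
    (fun i => ⟨t i, ht i, hlim i⟩)
  -- The mollified pieces are test functions only for small δ; for the remaining δ the zero function
  -- serves, which the limit does not see.
  let φs : ℝ → RN N → ℝ := fun δ =>
    if ∀ i, IsTestFunction Ω (ψ i δ) then fun x => ∑ i, ψ i δ x else fun _ => 0
  have htest : ∀ δ, IsTestFunction Ω (φs δ) := fun δ => by
    by_cases h : ∀ i, IsTestFunction Ω (ψ i δ)
    · simp only [φs, if_pos h]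
      exact IsTestFunction.sum _ h
    · simp only [φs, if_neg h]
      exact IsTestFunction.zero
  refine ⟨φs, fun δ _ => htest δ, Eventually.of_forall fun δ => ?_, ?_, s⁻¹, inv_pos.2 hs, ?_⟩
  · have hc := continuous_gradient (htest δ).smooth
    obtain ⟨D, -, hD⟩ := exists_bound_of_hasCompactSupport hc
      (hasCompactSupport_gradient (htest δ).compact_support)
    rw [orliczSpace_congr hae]
    exact Submodule.subset_span ⟨hc.aestronglyMeasurable,
      hM'.modular_lt_top_of_bounded hint (ae_of_all _ hD)⟩
  · rwa [orliczSpace_congr hae]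
  · refine hs'.congr' ?_
    filter_upwards [hψ'] with δ hδ
    rw [modular_congr hae]
    refine setLIntegral_congr_fun hΩm fun x hx => ?_
    have h1 : gradient (φs δ) x = ∑ i, gradient (ψ i δ) x := by
      simp only [φs, if_pos hδ]
      exact gradient_sum _ fun i _ => (hδ i).smooth.differentiable (by simp) x
    simp only [inv_inv]
    rw [h1, Finset.sum_sub_distrib, hpart x hx]
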